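/- **Theorem (Selfadjointness).** Let $\mathfrak H$ be a complex Hilbert space. For a $\sigma$-field $\mathcal B$ of subsets of a set $Z$, a *resolution of the identity (RI)* in $\mathfrak H$ on $\mathcal B$ is a map $E:\mathcal B\to\mathcal L(\mathfrak H)$ whose values are selfadjoint projections, with $E(\varnothing)=0$, $E(Z)=1$, $E(\sigma\cap\tau)=E(\sigma)E(\tau)$, $E(\sigma\cup\tau)=E(\sigma)+E(\tau)-E(\sigma)E(\tau)$, and countably additive in the weak operator topology. If $Z$ is a topological space with $\mathcal B=\mathcal B(Z)$ its Borel $\sigma$-field ($E$ is then a *Borel RI on $Z$*), $\operatorname{supp}(E)$ is the intersection of all closed $\delta\in\mathcal B$ with $E(\delta)=1$. For a bounded measurable $g:Z\to\mathbb C$ let $I^E(g)\in\mathcal L(\mathfrak H)$ be the integral of $g$, i.e. the extension by uniform limits of $\sum_i\lambda_i\chi_{\sigma_i}\mapsto\sum_i\lambda_iE(\sigma_i)$. For a measurable $f:Z\to\mathbb C$ put $f_n=f\cdot\chi_{\{|f|\le n\}}$; the operator $f(E)$ has domain $\{x\in\mathfrak H:\lim_n I^E(f_n)x\text{ exists}\}$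 and $f(E)x=\lim_nI^E(f_n)x$. The spectrum $\operatorname{sp}(T)$ of a possibly unbounded operator $T$ is the complement of the set of $\lambda\in\mathbb C$ for which $\lambda-T$ is a bijection of $\operatorname{Dom}(T)$ onto $\mathfrak H$ with bounded inverse. Let $X$ be a set, $\{R_x\}_{x\in X}$ a family of complete separable metric spaces, and $\mathcal E=\{E_x\}_{x\in X}$ a commuting family of Borel RI's in $\mathfrak H$, with $E_x$ on $R_x$ (that is, $E_y(\sigma)E_z(\tau)=E_z(\tau)E_y(\sigma)$ for all $y,z\in X$, $\sigma\in\mathcal B(R_y)$, $\tau\in\mathcal B(R_z)$). Put $R_X=\prod_{x\in X}R_x$, and for a finite $Q\subseteq X$ and $\delta\subseteq\prod_{x\in Q}R_x$ let $\mathfrak C(Q,\delta)=\{u\in R_X: u\upharpoonright Q\in\delta\}$. Let $\mathcal C_\sigma(R_X)$ be the $\sigma$-field on $R_X$ generated by the cylindrical sets, i.e. by the $\mathfrak C(Q,\delta)$ with $Q\subseteq X$ finite and $\delta$ in the product $\sigma$-field $\bigotimes_{x\in Q}\mathcal B(R_x)$. There is a unique RI $\mathsf E_{\mathcal E}$ in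 $\mathfrak H$ on $\mathcal C_\sigma(R_X)$ (the *joint RI* constructed from $\mathcal E$) such that $$\mathsf E_{\mathcal E}\Bigl(\mathfrak C\bigl(Q,\prod_{y\in Q}\delta_y\bigr)\Bigr)=\prod_{y\in Q}E_y(\delta_y)\qquad\text{for all finite }Q\subseteq X\text{ and all }\delta_y\in\mathcal B(R_y),\ y\in Q.$$ Let $f:R_X\to\mathbb C$ be $\mathcal C_\sigma(R_X)$-measurable. Then: 1. for every finite $Q\subseteq X$, $$\operatorname{sp}(f(\mathsf E_{\mathcal E}))\subseteq\overline{f\Bigl(\mathfrak C\bigl(Q,\prod_{x\in Q}\operatorname{supp}(E_x)\bigr)\Bigr)};$$ 2. if there is a finite $A\subseteq X$ with $\overline{f\bigl(\mathfrak C(A,\prod_{x\in A}\operatorname{supp}(E_x))\bigr)}\subseteq\mathbb R$, then $f(\mathsf E_{\mathcal E})$ is selfadjoint. -/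

import Mathlib

open Filter Topology MeasureTheory
open scoped UniformConvergence

/-- A resolution of the identity (RI) in the Hilbert space `H` on the `σ`-field of measurable
subsets of `Z`: a countably additive (for the weak operator topology) spectral measure whose values
are selfadjoint projections. As for Mathlib's `VectorMeasure`, the map is total on `Set Z` with the
value `0` on non-measurable sets, so that two RI's are equal exactly when they agree on the
`σ`-field. -/
structure ResolutionOfIdentity (H : Type*) [NormedAddCommGroup H] [InnerProductSpace ℂ H]
    [CompleteSpace H] (Z : Type*) [MeasurableSpace Z] where
  /-- The underlying operator valued set function. -/
  toFun : Set Z → H →L[ℂ] H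
  not_measurable' : ∀ σ, ¬ MeasurableSet σ → toFun σ = 0
  idem' : ∀ σ, MeasurableSet σ → toFun σ * toFun σ = toFun σ
  inter' : ∀ σ τ, MeasurableSet σ → MeasurableSet τ → toFun (σ ∩ τ) = toFun σ * toFun τ
  union' : ∀ σ τ, MeasurableSet σ → MeasurableSet τ →
    toFun (σ ∪ τ) = toFun σ + toFun τ - toFun σ * toFun τ
  univ' : toFun Set.univ = 1
  empty' : toFun ∅ = 0
  iUnion' : ∀ α : ℕ → Set Z, (∀ n, MeasurableSet (α n)) → Pairwise (Function.onFun Disjoint α) →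
    ∀ x y : H, HasSum (fun n => inner ℂ y (toFun (α n) x)) (inner ℂ y (toFun (⋃ n, α n) x))
  selfAdjoint' : ∀ σ, MeasurableSet σ → IsSelfAdjoint (toFun σ)

namespace ResolutionOfIdentity

section General

variable {H : Type*} [NormedAddCommGroup H] [InnerProductSpace ℂ H] [CompleteSpace H]
  {Z : Type*} [MeasurableSpace Z]

instance : CoeFun (ResolutionOfIdentity H Z) (fun _ => Set Z → H →L[ℂ] H) := ⟨toFun⟩

/-- The support: the intersection of the closed measurable sets `δ` with `E δ = 1`. -/
def supp [TopologicalSpace Z] (E : ResolutionOfIdentity H Z) : Set Z :=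
  ⋂₀ {δ | MeasurableSet δ ∧ IsClosed δ ∧ E δ = 1}

/-- The integral `∑ c • E {s = c}` of a simple function. -/
noncomputable def simpleIntegral (E : ResolutionOfIdentity H Z) (s : SimpleFunc Z ℂ) : H →L[ℂ] H :=
  ∑ c ∈ s.range, c • E (s ⁻¹' {c})

/-- The integral of a bounded measurable function: the extension by continuity of the integral of
simple functions, i.e. the limit in operator norm of `simpleIntegral E s` as the simple function
`s` tends to `g` uniformly on `Z`. It is only used for bounded measurable `g`, where this limit
exists. -/
noncomputable def boundedIntegral (E : ResolutionOfIdentity H Z) (g : Z → ℂ) : H →L[ℂ] H :=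
  limUnder (comap (fun s : SimpleFunc Z ℂ => UniformFun.ofFun (s : Z → ℂ))
    (𝓝 (UniformFun.ofFun g : Z →ᵤ ℂ))) E.simpleIntegral

/-- The truncation `f_n = f · χ_{|f| ≤ n}`. -/
noncomputable def trunc (f : Z → ℂ) (n : ℕ) : Z → ℂ :=
  Set.indicator {z | ‖f z‖ ≤ n} f

/-- The functional calculus `f(E)`: the unbounded operator with domain the set of `x` for which
`lim_n (∫ f_n dE) x` exists, and with this limit as value at `x`. -/
noncomputable def functionalCalculus (E : ResolutionOfIdentity H Z) (f : Z → ℂ) : H →ₗ.[ℂ] H where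
  domain :=
    { carrier := {x | ∃ l : H, Tendsto (fun n : ℕ => E.boundedIntegral (trunc f n) x) atTop (𝓝 l)}
      add_mem' := by
        rintro x y ⟨a, ha⟩ ⟨b, hb⟩
        exact ⟨a + b, by simpa using ha.add hb⟩
      zero_mem' := ⟨0, by simp⟩
      smul_mem' := by
        rintro c x ⟨a, ha⟩
        exact ⟨c • a, by simpa using ha.const_smul c⟩ }
  toFun :=
    { toFun := fun x => limUnder atTop (fun n : ℕ => E.boundedIntegral (trunc f n) (x : H))
      map_add' := by
        rintro ⟨x, a, ha⟩ ⟨y, b, hb⟩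
        have h : Tendsto (fun n : ℕ => E.boundedIntegral (trunc f n) (x + y)) atTop (𝓝 (a + b)) := by
          simpa using ha.add hb
        exact h.limUnder_eq.trans (congrArg₂ (· + ·) ha.limUnder_eq hb.limUnder_eq).symm
      map_smul' := by
        rintro c ⟨x, a, ha⟩
        have h : Tendsto (fun n : ℕ => E.boundedIntegral (trunc f n) (c • x)) atTop (𝓝 (c • a)) := by
          simpa using ha.const_smul c
        exact h.limUnder_eq.trans (congrArg (fun v => c • v) ha.limUnder_eq).symm }

end General

section Family

variable {H : Type*} [NormedAddCommGroup H] [InnerProductSpace ℂ H] [CompleteSpace H]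
  {X : Type*} {R : X → Type*} [∀ x, MeasurableSpace (R x)]

/-- All the projections of all the members of the family commute. -/
def IsCommutingFamily (E : ∀ x, ResolutionOfIdentity H (R x)) : Prop :=
  ∀ (y z : X) (σ : Set (R y)) (τ : Set (R z)), MeasurableSet σ → MeasurableSet τ →
    Commute (E y σ) (E z τ)

/-- `J` is the joint RI constructed from the commuting family `E`. The `σ`-field on the product
`∀ x, R x` is the product `σ`-field, i.e. the one generated by the cylindrical sets
(`MeasureTheory.generateFrom_measurableCylinders`). On the cylinder over a finite `Q` with base a
box `∏ δ y` (`y ∈ Q`), `J` is the product of the commuting projections `E y (δ y)`. -/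
def IsJoint (E : ∀ x, ResolutionOfIdentity H (R x)) (hE : IsCommutingFamily E)
    (J : ResolutionOfIdentity H (∀ x, R x)) : Prop :=
  ∀ (Q : Finset X) (δ : ∀ x, Set (R x)) (hδ : ∀ x, MeasurableSet (δ x)),
    J (cylinder Q (Set.univ.pi fun y : Q => δ y)) =
      Q.noncommProd (fun y => E y (δ y))
        (fun y _ z _ _ => hE y z (δ y) (δ z) (hδ y) (hδ z))

/-- The cylinder `{u | u x ∈ supp (E x) for all x ∈ Q}`. -/
def suppCylinder [∀ x, TopologicalSpace (R x)] (E : ∀ x, ResolutionOfIdentity H (R x))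
    (Q : Finset X) : Set (∀ x, R x) :=
  cylinder Q (Set.univ.pi fun x : Q => (E x).supp)

end Family

end ResolutionOfIdentity

/-- The spectrum of an unbounded operator `T`: the complement of the set of those `c` for which
`c - T`, as a map from the domain of `T` to `H`, has an everywhere defined bounded inverse `B`. -/
def unboundedSpectrum {H : Type*} [NormedAddCommGroup H] [InnerProductSpace ℂ H]
    (T : H →ₗ.[ℂ] H) : Set ℂ :=
  {c | ¬ ∃ B : H →L[ℂ] H,
    (∀ y : H, ∃ h : B y ∈ T.domain, c • B y - T ⟨B y, h⟩ = y) ∧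
    ∀ x : T.domain, B (c • (x : H) - T x) = x}

/-!
The joint resolution of the identity is obtained from Gelfand duality. All the projections
`E x σ` generate a commutative C⋆-algebra, isomorphic to `C(K)` for its character space `K`. The
inverse Gelfand transform represents `C(K)` on `H`, and the Riesz–Markov–Kakutani theorem turns
each functional `g ↦ ⟪v, g v⟫` into a measure on `K`. The class of sets on which these measures are
the quadratic form of a projection is a Dynkin class containing the clopen sets, so it contains the
`σ`-field they generate, and the measures come from a resolution of the identity `F` on `K`
(`exists_of_representation`). Each `E x σ`, being a projection, is the value of `F` on the clopen
set of characters with value `1` at `E x σ` (`exists_of_commuting_projections`). A nonempty Polish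
space is a measurable retract of the Cantor space, so a point of `R x` can be read off measurably
from countably many bits, that is, from countably many of these clopen sets; this is the only use
of completeness and separability in the construction. The resulting measurable map from `K` to the
product pushes `F` forward to a joint resolution of the identity (`exists_isJoint`). No regularity
or consistency argument over the finite subproducts is needed, and uncountable index sets cause no
difficulty.

Two resolutions of the identity that agree on a generating family of sets agree
(`ext_of_generateFrom`). By multiplicativity, being joint amounts to having the given coordinate
marginals (`isJoint_iff`), and the preimages under the coordinate maps generate the product
`σ`-field, so a joint resolution of the identity is unique.

For a resolution of the identity `E` the identities `⟪v, I(g) v⟫ = ∫ g dμ_v` and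
`‖I(g) v‖² = ∫ |g|² dμ_v`, where `μ_v s = ‖E s v‖²`, make the bounded integral `I` a
⋆-homomorphism with a dominated convergence theorem (`tendsto_boundedIntegral`). Suppose that `E`
is carried by `S`. If `c` is not in the closure of `f(S)`, then `I(1_S / (c - f))` is a bounded
inverse of `c - f(E)` (`unboundedSpectrum_functionalCalculus_subset`). If `f(S)` has closure in
`ℝ`, then `f(E)` is symmetric and both `±i - f(E)` are onto, so `f(E)` is selfadjoint
(`isSelfAdjoint_functionalCalculus`). Finally, a joint resolution of the identity is carried by
each cylinder over finitely many supports, because in a second countable space the complement of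
the support is null (`IsJoint.apply_suppCylinder`).
-/

/-! ### Scalar spectral measures, and resolutions of the identity from measures -/

namespace ResolutionOfIdentity

section Basic

/-- Over `ℂ`, an operator is determined by its quadratic form. -/
lemma eq_of_inner_self {H : Type*} [NormedAddCommGroup H] [InnerProductSpace ℂ H]
    {S T : H →L[ℂ] H} (h : ∀ v, inner ℂ v (S v) = inner ℂ v (T v)) : S = T := by
  have : (S : H →ₗ[ℂ] H) = T := by
    rw [← ext_inner_map]
    intro v
    rw [← inner_conj_symm, ← inner_conj_symm _ v]
    exact congrArg _ (h v)
  exact ContinuousLinearMap.coe_injective this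

variable {H : Type*} [NormedAddCommGroup H] [InnerProductSpace ℂ H] [CompleteSpace H]
  {Z : Type*} [MeasurableSpace Z]

lemma inner_self_of_isStarProjection {T : H →L[ℂ] H} (hT : IsStarProjection T) (v : H) :
    inner ℂ v (T v) = ((‖T v‖ ^ 2 : ℝ) : ℂ) := by
  have h1 : T (T v) = T v := congrArg (fun S : H →L[ℂ] H => S v) hT.isIdempotentElem
  have h2 : ContinuousLinearMap.adjoint T = T := hT.isSelfAdjoint
  calc inner ℂ v (T v) = inner ℂ v (T (T v)) := by rw [h1]
    _ = inner ℂ (ContinuousLinearMap.adjoint T v) (T v) :=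
        (ContinuousLinearMap.adjoint_inner_left T _ _).symm
    _ = _ := by rw [h2, inner_self_eq_norm_sq_to_K]; push_cast; rfl

@[ext]
lemma ext {E F : ResolutionOfIdentity H Z} (h : ∀ s, MeasurableSet s → E s = F s) : E = F := by
  have : E.toFun = F.toFun := by
    ext1 s
    by_cases hs : MeasurableSet s
    · exact h s hs
    · rw [E.not_measurable' s hs, F.not_measurable' s hs]
  cases E; cases F; congr

variable (E : ResolutionOfIdentity H Z)

lemma isStarProjection {s : Set Z} (hs : MeasurableSet s) : IsStarProjection (E s) :=
  ⟨E.idem' s hs, E.selfAdjoint' s hs⟩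

lemma inner_apply_self {s : Set Z} (hs : MeasurableSet s) (v : H) :
    inner ℂ v (E s v) = ((‖E s v‖ ^ 2 : ℝ) : ℂ) :=
  inner_self_of_isStarProjection (E.isStarProjection hs) v

lemma apply_union_of_disjoint {s t : Set Z} (hs : MeasurableSet s) (ht : MeasurableSet t)
    (h : Disjoint s t) : E (s ∪ t) = E s + E t := by
  rw [E.union' s t hs ht, ← E.inter' s t hs ht, h.inter_eq, E.empty', sub_zero]

lemma apply_compl {s : Set Z} (hs : MeasurableSet s) : E sᶜ = 1 - E s := by
  have := E.apply_union_of_disjoint hs hs.compl disjoint_compl_right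
  rw [Set.union_compl_self, E.univ'] at this
  rw [this, add_sub_cancel_left]

lemma hasSum_norm_sq {α : ℕ → Set Z} (hα : ∀ n, MeasurableSet (α n))
    (hd : Pairwise (Function.onFun Disjoint α)) (v : H) :
    HasSum (fun n => ‖E (α n) v‖ ^ 2) (‖E (⋃ n, α n) v‖ ^ 2) := by
  have := E.iUnion' α hα hd v v
  rw [E.inner_apply_self (.iUnion hα)] at this
  simp only [E.inner_apply_self (hα _)] at this
  exact_mod_cast this

/-- The scalar spectral measure `s ↦ ‖E s v‖² = ⟪v, E s v⟫` of a vector `v`. -/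
noncomputable def diagMeasure (v : H) : Measure Z :=
  Measure.ofMeasurable (fun s _ => ENNReal.ofReal (‖E s v‖ ^ 2)) (by simp [E.empty'])
    (fun α hα hd => by
      have := E.hasSum_norm_sq hα hd v
      rw [← this.tsum_eq, ENNReal.ofReal_tsum_of_nonneg (fun _ => by positivity) this.summable])

lemma diagMeasure_apply {s : Set Z} (hs : MeasurableSet s) (v : H) :
    E.diagMeasure v s = ENNReal.ofReal (‖E s v‖ ^ 2) :=
  Measure.ofMeasurable_apply s hs

lemma diagMeasure_univ (v : H) : E.diagMeasure v Set.univ = ENNReal.ofReal (‖v‖ ^ 2) := by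
  rw [E.diagMeasure_apply .univ, E.univ', one_apply_eq_self]

instance (v : H) : IsFiniteMeasure (E.diagMeasure v) :=
  ⟨by rw [diagMeasure_univ]; exact ENNReal.ofReal_lt_top⟩

lemma diagMeasure_real {s : Set Z} (hs : MeasurableSet s) (v : H) :
    (E.diagMeasure v).real s = ‖E s v‖ ^ 2 := by
  rw [Measure.real, E.diagMeasure_apply hs, ENNReal.toReal_ofReal (by positivity)]

lemma apply_eq_of_diagMeasure_eq {F : ResolutionOfIdentity H Z} {s : Set Z}
    (hs : MeasurableSet s) (h : ∀ v, E.diagMeasure v s = F.diagMeasure v s) : E s = F s :=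
  eq_of_inner_self fun v => by
    rw [E.inner_apply_self hs, F.inner_apply_self hs, ← E.diagMeasure_real hs,
      ← F.diagMeasure_real hs, Measure.real, Measure.real, h]

lemma apply_eq_one_iff {s : Set Z} (hs : MeasurableSet s) :
    E s = 1 ↔ ∀ v, E.diagMeasure v sᶜ = 0 := by
  have : E s = 1 ↔ E sᶜ = 0 := by
    rw [E.apply_compl hs, sub_eq_zero, eq_comm]
  rw [this]
  refine ⟨fun h v => by simp [E.diagMeasure_apply hs.compl, h], fun h => ?_⟩
  ext v
  have := h v
  rw [E.diagMeasure_apply hs.compl, ENNReal.ofReal_eq_zero] at this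
  have h0 : ‖E sᶜ v‖ ^ 2 = 0 := le_antisymm this (by positivity)
  simpa using h0

/-- Two resolutions of the identity that agree on a generating family agree. By multiplicativity
the sets of agreement are closed under finite intersections, so the generating family need not
be a `π`-system. -/
lemma ext_of_generateFrom {C : Set (Set Z)} {E F : ResolutionOfIdentity H Z}
    (hC : ‹MeasurableSpace Z› = MeasurableSpace.generateFrom C)
    (h : ∀ s ∈ C, E s = F s) : E = F := by
  have hdisj : ∀ α : ℕ → Set Z, (∀ n, MeasurableSet (α n)) → (∀ n, E (α n) = F (α n)) →
      Pairwise (Function.onFun Disjoint α) → E (⋃ n, α n) = F (⋃ n, α n) := by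
    intro α hm he hd
    refine E.apply_eq_of_diagMeasure_eq (.iUnion hm) fun v => ?_
    rw [measure_iUnion hd hm, measure_iUnion hd hm]
    simp only [E.diagMeasure_apply (hm _), F.diagMeasure_apply (hm _), he]
  have key : ∀ s, MeasurableSet s → MeasurableSet s ∧ E s = F s := by
    intro s hs
    refine MeasurableSpace.generateFrom_induction C
      (fun s _ => MeasurableSet s ∧ E s = F s) ?_ ?_ ?_ ?_ s (hC ▸ hs)
    · intro t ht _
      exact ⟨by rw [hC]; exact .basic t ht, h t ht⟩
    · exact ⟨.empty, by rw [E.empty', F.empty']⟩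
    · rintro t _ ⟨hm, he⟩
      exact ⟨hm.compl, by rw [E.apply_compl hm, F.apply_compl hm, he]⟩
    · intro α _ hα
      have hinter : ∀ s t, (MeasurableSet s ∧ E s = F s) → (MeasurableSet t ∧ E t = F t) →
          (MeasurableSet (s \ t) ∧ E (s \ t) = F (s \ t)) := by
        rintro s t ⟨hs, hs'⟩ ⟨ht, ht'⟩
        refine ⟨hs.diff ht, ?_⟩
        rw [Set.sdiff_eq, E.inter' _ _ hs ht.compl, F.inter' _ _ hs ht.compl, E.apply_compl ht,
          F.apply_compl ht, hs', ht']
      have hd : ∀ n, MeasurableSet (disjointed α n) ∧ E (disjointed α n) = F (disjointed α n) :=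
        fun n =>
          disjointedRec (p := fun t => MeasurableSet t ∧ E t = F t)
            (fun _ i ht => hinter _ _ ht (hα i)) (hα n)
      refine ⟨.iUnion fun n => (hα n).1, ?_⟩
      rw [← iUnion_disjointed]
      exact hdisj _ (fun n => (hd n).1) (fun n => (hd n).2) (disjoint_disjointed α)
  exact ext fun s hs => (key s hs).2

/-- The support is closed. -/
lemma isClosed_supp [TopologicalSpace Z] : IsClosed E.supp :=
  isClosed_sInter fun _ h => h.2.1

/-- In a second countable space the complement of the support is a countable union of null sets,
so the support carries the whole resolution of the identity. -/
lemma apply_supp [TopologicalSpace Z] [SecondCountableTopology Z] [BorelSpace Z] :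
    E E.supp = 1 := by
  rw [E.apply_eq_one_iff E.isClosed_supp.measurableSet]
  intro v
  obtain ⟨T, hT, hTc, hTU⟩ := TopologicalSpace.isOpen_sUnion_countable
    (compl '' {δ | MeasurableSet δ ∧ IsClosed δ ∧ E δ = 1})
    (by rintro _ ⟨δ, hδ, rfl⟩; exact hδ.2.1.isOpen_compl)
  rw [supp, Set.compl_sInter, ← hTU, measure_sUnion_null_iff hT]
  intro t ht
  obtain ⟨δ, hδ, rfl⟩ := hTc ht
  exact (E.apply_eq_one_iff hδ.1).1 hδ.2.2 v

/-- A family of measures, indexed by the vectors of `H`, each of whose values on a measurable set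
is the quadratic form of a selfadjoint projection, comes from a resolution of the identity. -/
theorem exists_of_measures (μ : H → Measure Z)
    (huniv : ∀ v, μ v Set.univ = ENNReal.ofReal (‖v‖ ^ 2))
    (h : ∀ s, MeasurableSet s → ∃ T : H →L[ℂ] H, IsStarProjection T ∧
      ∀ v, μ v s = ENNReal.ofReal (‖T v‖ ^ 2)) :
    ∃ E : ResolutionOfIdentity H Z, ∀ s, MeasurableSet s → ∀ v,
      μ v s = ENNReal.ofReal (‖E s v‖ ^ 2) := by
  classical
  choose! T hT hμ using h
  have hfin : ∀ v, IsFiniteMeasure (μ v) := fun v => ⟨by rw [huniv]; exact ENNReal.ofReal_lt_top⟩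
  have hreal : ∀ s, MeasurableSet s → ∀ v, (μ v).real s = ‖T s v‖ ^ 2 := fun s hs v => by
    rw [Measure.real, hμ s hs, ENNReal.toReal_ofReal (by positivity)]
  have hin : ∀ s, MeasurableSet s → ∀ v, inner ℂ v (T s v) = (((μ v).real s : ℝ) : ℂ) :=
    fun s hs v => by rw [inner_self_of_isStarProjection (hT s hs), hreal s hs]
  have hadd : ∀ s t, MeasurableSet s → MeasurableSet t → Disjoint s t →
      T (s ∪ t) = T s + T t := fun s t hs ht hd => eq_of_inner_self fun v => by
    rw [add_apply, inner_add_right, hin s hs, hin t ht, hin _ (hs.union ht),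
      measureReal_union hd ht]
    push_cast; rfl
  have hu : T Set.univ = 1 := eq_of_inner_self fun v => by
    rw [hin _ .univ, Measure.real, huniv, ENNReal.toReal_ofReal (by positivity),
      one_apply_eq_self, inner_self_eq_norm_sq_to_K]
    push_cast; rfl
  have he : T ∅ = 0 := eq_of_inner_self fun v => by simp [hin]
  -- disjoint sets give orthogonal projections, since `‖T t w‖² + ‖T s w‖² ≤ ‖w‖²` for `w = T s v`
  have hmul0 : ∀ s t, MeasurableSet s → MeasurableSet t → Disjoint s t → T t * T s = 0 := by
    intro s t hs ht hd
    ext v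
    have h1 : T s (T s v) = T s v := congrArg (fun S : H →L[ℂ] H => S v) (hT s hs).isIdempotentElem
    have h2 : (μ (T s v)).real (s ∪ t) ≤ (μ (T s v)).real Set.univ :=
      measureReal_mono (Set.subset_univ _)
    rw [measureReal_union hd ht, hreal s hs, hreal t ht, h1, Measure.real, huniv,
      ENNReal.toReal_ofReal (by positivity)] at h2
    have h3 : ‖T t (T s v)‖ ^ 2 = 0 := le_antisymm (by linarith) (by positivity)
    simpa using h3
  have hinter : ∀ s t, MeasurableSet s → MeasurableSet t → T (s ∩ t) = T s * T t := by
    intro s t hs ht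
    have e1 : T s = T (s ∩ t) + T (s \ t) := by
      rw [← hadd _ _ (hs.inter ht) (hs.diff ht) Set.disjoint_sdiff_inter.symm,
        Set.inter_union_sdiff]
    have e2 : T t = T (s ∩ t) + T (t \ s) := by
      rw [Set.inter_comm, ← hadd _ _ (ht.inter hs) (ht.diff hs) Set.disjoint_sdiff_inter.symm,
        Set.inter_union_sdiff]
    have d1 : Disjoint (t \ s) (s ∩ t) := by
      rw [Set.inter_comm]; exact Set.disjoint_sdiff_inter
    have d2 : Disjoint (s ∩ t) (s \ t) := Set.disjoint_sdiff_inter.symm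
    have d3 : Disjoint (t \ s) (s \ t) := disjoint_sdiff_sdiff
    rw [e1, e2, mul_add, add_mul, add_mul, hmul0 _ _ (ht.diff hs) (hs.inter ht) d1,
      hmul0 _ _ (hs.inter ht) (hs.diff ht) d2, hmul0 _ _ (ht.diff hs) (hs.diff ht) d3,
      (hT _ (hs.inter ht)).isIdempotentElem.eq]
    simp
  have hval : ∀ s, MeasurableSet s → (if MeasurableSet s then T s else 0) = T s :=
    fun s hs => if_pos hs
  refine ⟨⟨fun s => if MeasurableSet s then T s else 0, fun s hs => if_neg hs, ?_, ?_, ?_, ?_, ?_,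
    ?_, ?_⟩, ?_⟩
  · intro s hs
    rw [hval s hs, (hT s hs).isIdempotentElem.eq]
  · intro s t hs ht
    rw [hval s hs, hval t ht, hval _ (hs.inter ht), hinter s t hs ht]
  · intro s t hs ht
    rw [hval s hs, hval t ht, hval _ (hs.union ht), ← hinter s t hs ht, ← Set.union_sdiff_self,
      hadd _ _ hs (ht.diff hs) Set.disjoint_sdiff_right, add_sub_assoc, add_right_inj,
      eq_sub_iff_add_eq, ← hadd _ _ (ht.diff hs) (hs.inter ht), Set.inter_comm,
      Set.sdiff_union_inter]
    rw [Set.inter_comm]; exact Set.disjoint_sdiff_inter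
  · rw [hval _ .univ, hu]
  · rw [hval _ .empty, he]
  · intro α hα hd x y
    rw [hval _ (.iUnion hα)]
    simp only [hval _ (hα _)]
    have hflip : ∀ s, MeasurableSet s → ∀ v w, inner ℂ (T s v) w = inner ℂ v (T s w) := by
      intro s hs v w
      have : ContinuousLinearMap.adjoint (T s) = T s := (hT s hs).isSelfAdjoint
      rw [← ContinuousLinearMap.adjoint_inner_left, this]
    have hq : ∀ v, HasSum (fun n => inner ℂ (T (α n) v) v) (inner ℂ (T (⋃ n, α n) v) v) := by
      intro v
      rw [hflip _ (.iUnion hα), hin _ (.iUnion hα)]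
      simp only [hflip _ (hα _), hin _ (hα _)]
      rw [Complex.hasSum_ofReal]
      have := ENNReal.hasSum_toReal (f := fun n => μ v (α n))
        (by rw [← measure_iUnion hd hα]; exact measure_ne_top _ _)
      rw [← ENNReal.tsum_toReal_eq (fun n => measure_ne_top _ _), ← measure_iUnion hd hα] at this
      exact this
    have hpol := fun s (hs : MeasurableSet s) =>
      (hflip s hs y x).symm.trans (inner_map_polarization (T s : H →ₗ[ℂ] H) x y)
    rw [hpol _ (.iUnion hα)]
    simp only [hpol _ (hα _)]
    exact ((((hq (x + y)).sub (hq (x - y))).add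
      ((hq (x + Complex.I • y)).mul_left Complex.I)).sub
      ((hq (x - Complex.I • y)).mul_left Complex.I)).div_const 4
  · intro s hs
    rw [hval s hs]
    exact hT s hs |>.isSelfAdjoint
  · intro s hs v
    change _ = ENNReal.ofReal (‖(if MeasurableSet s then T s else 0) v‖ ^ 2)
    rw [hval s hs, hμ s hs]

/-- The pushforward of a resolution of the identity along a measurable map. -/
theorem exists_map {Z' : Type*} [MeasurableSpace Z'] {g : Z → Z'} (hg : Measurable g) :
    ∃ F : ResolutionOfIdentity H Z', ∀ s, MeasurableSet s → F s = E (g ⁻¹' s) := by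
  obtain ⟨F, hF⟩ := exists_of_measures (fun v => (E.diagMeasure v).map g)
    (fun v => by rw [Measure.map_apply hg .univ, Set.preimage_univ, diagMeasure_univ])
    (fun s hs => ⟨E (g ⁻¹' s), E.isStarProjection (hg hs), fun v => by
      rw [Measure.map_apply hg hs, E.diagMeasure_apply (hg hs)]⟩)
  refine ⟨F, fun s hs => eq_of_inner_self fun v => ?_⟩
  have := hF s hs v
  rw [Measure.map_apply hg hs, E.diagMeasure_apply (hg hs),
    ENNReal.ofReal_eq_ofReal_iff (by positivity) (by positivity)] at this
  rw [F.inner_apply_self hs, E.inner_apply_self (hg hs), this]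

end Basic

end ResolutionOfIdentity

/-! ### Spectral measures of representations of `C(K)` -/

namespace ResolutionOfIdentity

section Representation

open scoped CompactlySupported

variable {H : Type*} [NormedAddCommGroup H] [InnerProductSpace ℂ H] [CompleteSpace H]

/-- The strong sum of a sequence of mutually orthogonal projections. -/
lemma exists_isStarProjection_hasSum {T : ℕ → H →L[ℂ] H} (hT : ∀ n, IsStarProjection (T n))
    (horth : ∀ m n, m ≠ n → T m * T n = 0) :
    ∃ P : H →L[ℂ] H, IsStarProjection P ∧ ∀ v, HasSum (fun n => ‖T n v‖ ^ 2) (‖P v‖ ^ 2) := by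
  have hflip : ∀ n v w, inner ℂ (T n v) w = inner ℂ v (T n w) := fun n v w => by
    have : ContinuousLinearMap.adjoint (T n) = T n := (hT n).isSelfAdjoint
    rw [← ContinuousLinearMap.adjoint_inner_left, this]
  have hTT : ∀ m n v, m ≠ n → T m (T n v) = 0 := fun m n v h =>
    congrArg (fun S : H →L[ℂ] H => S v) (horth m n h)
  have hTi : ∀ n v, T n (T n v) = T n v := fun n v =>
    congrArg (fun S : H →L[ℂ] H => S v) (hT n).isIdempotentElem
  have hfam : OrthogonalFamily ℂ (fun n => LinearMap.range (T n : H →ₗ[ℂ] H))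
      (fun n => (LinearMap.range (T n : H →ₗ[ℂ] H)).subtypeₗᵢ) := by
    rintro m n hmn ⟨_, v, rfl⟩ ⟨_, w, rfl⟩
    change inner ℂ (T m v) (T n w) = 0
    rw [hflip, hTT m n w hmn, inner_zero_right]
  have hbessel : ∀ v (s : Finset ℕ), ∑ n ∈ s, ‖T n v‖ ^ 2 ≤ ‖v‖ ^ 2 := by
    intro v s
    have h1 : ‖∑ n ∈ s, T n v‖ ^ 2 = ∑ n ∈ s, ‖T n v‖ ^ 2 :=
      hfam.norm_sum (fun n => ⟨T n v, v, rfl⟩) s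
    have h2 : inner ℂ v (∑ n ∈ s, T n v) = ((∑ n ∈ s, ‖T n v‖ ^ 2 : ℝ) : ℂ) := by
      rw [inner_sum, Complex.ofReal_sum]
      exact Finset.sum_congr rfl fun n _ => inner_self_of_isStarProjection (hT n) v
    have h3 : ∑ n ∈ s, ‖T n v‖ ^ 2 ≤ ‖v‖ * ‖∑ n ∈ s, T n v‖ := by
      have := norm_inner_le_norm (𝕜 := ℂ) v (∑ n ∈ s, T n v)
      rw [h2, Complex.norm_real] at this
      exact (le_abs_self _).trans this
    rw [← h1] at h3 ⊢
    nlinarith [norm_nonneg v, norm_nonneg (∑ n ∈ s, T n v)]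
  have hsum : ∀ v, Summable (fun n => T n v) := fun v =>
    (hfam.summable_iff_norm_sq_summable (fun n => ⟨T n v, v, rfl⟩)).2
      (summable_of_sum_le (fun _ => by positivity) (hbessel v))
  let P : H →L[ℂ] H := continuousLinearMapOfTendsto (fun N : ℕ => ∑ n ∈ Finset.range N, T n)
    (f := fun v => ∑' n, T n v) (l := atTop) (by
      rw [tendsto_pi_nhds]
      intro v
      simpa using (hsum v).hasSum.tendsto_sum_nat)
  have hP : ∀ v, HasSum (fun n => T n v) (P v) := fun v => (hsum v).hasSum
  have hTP : ∀ n v, T n (P v) = T n v := fun n v => by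
    have h1 := (hP v).mapL (T n)
    refine h1.unique ?_
    convert hasSum_single n (fun m hm => hTT n m v hm.symm) using 1
    exact (hTi n v).symm
  have hPP : IsStarProjection P := by
    refine ⟨?_, ?_⟩
    · ext v
      refine (hP (P v)).unique ?_
      simp only [hTP]
      exact hP v
    · rw [ContinuousLinearMap.isSelfAdjoint_iff_isSymmetric]
      intro v w
      have h1 : HasSum (fun n => inner ℂ (T n v) w) (inner ℂ (P v) w) :=
        (hP v).mapL (innerSLFlip ℂ w)
      have h2 : HasSum (fun n => inner ℂ v (T n w)) (inner ℂ v (P w)) :=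
        (hP w).mapL (innerSL ℂ v)
      simp only [hflip] at h1
      exact h1.unique h2
  refine ⟨P, hPP, fun v => ?_⟩
  have h1 : HasSum (fun n => inner ℂ v (T n v)) (inner ℂ v (P v)) :=
    (hP v).mapL (innerSL ℂ v)
  rw [inner_self_of_isStarProjection hPP] at h1
  simp only [inner_self_of_isStarProjection (hT _)] at h1
  exact Complex.hasSum_ofReal.1 h1

variable {K : Type*} [TopologicalSpace K] [CompactSpace K] [T2Space K]

/-- The real continuous functions inside the complex ones. -/
noncomputable def complexify (f : C(K, ℝ)) : C(K, ℂ) := ⟨fun x => (f x : ℂ), by fun_prop⟩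

/-- The indicator of a clopen set as a continuous function. -/
noncomputable def clopenIndicator {s : Set K} (hs : IsClopen s) : C(K, ℂ) :=
  ⟨s.indicator 1, hs.continuous_indicator continuous_one⟩

/-- The scalar measures of a representation of `C(K)`, by the Riesz–Markov–Kakutani theorem. -/
lemma exists_measure_of_representation [MeasurableSpace K] [BorelSpace K]
    (ρ : C(K, ℂ) →⋆ₐ[ℂ] (H →L[ℂ] H)) (v : H) :
    ∃ μ : Measure K, IsFiniteMeasure μ ∧
      ∀ f : C(K, ℝ), ∫ x, f x ∂μ = (inner ℂ v (ρ (complexify f) v)).re := by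
  let L : C_c(K, ℝ) →ₗ[ℝ] ℝ :=
    { toFun := fun f => (inner ℂ v (ρ (complexify (f : C(K, ℝ))) v)).re
      map_add' := fun f g => by
        have : complexify ((f + g : C_c(K, ℝ)) : C(K, ℝ)) =
          complexify (f : C(K, ℝ)) + complexify (g : C(K, ℝ)) := by ext; simp [complexify]
        rw [this, map_add, add_apply, inner_add_right, Complex.add_re]
      map_smul' := fun c f => by
        have : complexify ((c • f : C_c(K, ℝ)) : C(K, ℝ)) =
          (c : ℂ) • complexify (f : C(K, ℝ)) := by ext; simp [complexify]
        rw [this, map_smul, smul_apply, inner_smul_right, Complex.re_ofReal_mul]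
        rfl }
  let Λ : C_c(K, ℝ) →ₚ[ℝ] ℝ := PositiveLinearMap.mk₀ L fun f hf => by
    -- `f = g²` with `g = √f`, so `⟪v, ρ f v⟫ = ‖ρ g v‖²`
    let g : C(K, ℂ) := complexify ⟨fun x => Real.sqrt (f x), by fun_prop⟩
    have hg : complexify (f : C(K, ℝ)) = star g * g := by
      ext x
      have : Real.sqrt (f x) * Real.sqrt (f x) = f x := Real.mul_self_sqrt (hf x)
      simp only [complexify, g, ContinuousMap.mul_apply, ContinuousMap.star_apply,
        ContinuousMap.coe_mk]
      rw [Complex.star_def, Complex.conj_ofReal, ← Complex.ofReal_mul, this]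
    change 0 ≤ (inner ℂ v (ρ (complexify (f : C(K, ℝ))) v)).re
    rw [hg, map_mul, map_star, ContinuousLinearMap.star_eq_adjoint,
      mul_apply_eq_comp, ContinuousLinearMap.adjoint_inner_right]
    exact inner_self_nonneg (𝕜 := ℂ)
  refine ⟨RealRMK.rieszMeasure Λ, inferInstance, fun f => ?_⟩
  exact RealRMK.integral_rieszMeasure Λ ⟨f, HasCompactSupport.of_compactSpace f⟩

/-- The scalar measures of a representation of `C(K)` are quadratic forms of projections, at least
on the `σ`-field generated by the clopen sets. -/
lemma exists_measures_of_representation [MeasurableSpace K] [BorelSpace K]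
    (ρ : C(K, ℂ) →⋆ₐ[ℂ] (H →L[ℂ] H)) :
    ∃ μ : H → Measure K, (∀ v, μ v Set.univ = ENNReal.ofReal (‖v‖ ^ 2)) ∧
      (∀ s (hs : IsClopen s), IsStarProjection (ρ (clopenIndicator hs)) ∧
        ∀ v, μ v s = ENNReal.ofReal (‖ρ (clopenIndicator hs) v‖ ^ 2)) ∧
      ∀ s, MeasurableSet[.generateFrom {s : Set K | IsClopen s}] s →
        ∃ T : H →L[ℂ] H, IsStarProjection T ∧ ∀ v, μ v s = ENNReal.ofReal (‖T v‖ ^ 2) := by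
  choose μ hfin hμ using exists_measure_of_representation ρ
  have hle : MeasurableSpace.generateFrom {s : Set K | IsClopen s} ≤ ‹_› :=
    MeasurableSpace.generateFrom_le fun s hs => hs.isOpen.measurableSet
  have hproj : ∀ s (hs : IsClopen s), IsStarProjection (ρ (clopenIndicator hs)) := by
    intro s hs
    have : IsStarProjection (clopenIndicator hs) := by
      constructor
      · ext x
        by_cases h : x ∈ s <;> simp [clopenIndicator, h]
      · ext x
        by_cases h : x ∈ s <;> simp [clopenIndicator, h]
    exact this.map ρ
  have hclopen : ∀ s (hs : IsClopen s) v,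
      μ v s = ENNReal.ofReal (‖ρ (clopenIndicator hs) v‖ ^ 2) := by
    intro s hs v
    have h1 := hμ v ⟨s.indicator 1, hs.continuous_indicator continuous_one⟩
    have h2 : complexify (⟨s.indicator 1, hs.continuous_indicator continuous_one⟩ : C(K, ℝ)) =
        clopenIndicator hs := by
      ext x
      by_cases h : x ∈ s <;> simp [clopenIndicator, complexify, h]
    rw [h2, inner_self_of_isStarProjection (hproj s hs), Complex.ofReal_re] at h1
    rw [← h1, ContinuousMap.coe_mk, integral_indicator_one hs.isOpen.measurableSet,
      ofReal_measureReal]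
  have huniv : ∀ v, μ v Set.univ = ENNReal.ofReal (‖v‖ ^ 2) := by
    intro v
    have : clopenIndicator (isClopen_univ (X := K)) = 1 := by ext; simp [clopenIndicator]
    rw [hclopen _ isClopen_univ, this, map_one, one_apply_eq_self]
  refine ⟨μ, huniv, fun s hs => ⟨hproj s hs, hclopen s hs⟩, ?_⟩
  · refine MeasurableSpace.induction_on_inter rfl (fun s hs t ht _ => hs.inter ht) ?_ ?_ ?_ ?_
    · exact ⟨0, .zero _, by simp⟩
    · exact fun s hs => ⟨_, hproj s hs, hclopen s hs⟩
    · rintro s hs ⟨T, hT, h⟩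
      refine ⟨1 - T, hT.one_sub, fun v => ?_⟩
      have h1 : ((‖(1 - T) v‖ ^ 2 : ℝ) : ℂ) = ((‖v‖ ^ 2 - ‖T v‖ ^ 2 : ℝ) : ℂ) := by
        rw [← inner_self_of_isStarProjection hT.one_sub, sub_apply, one_apply_eq_self,
          inner_sub_right, inner_self_of_isStarProjection hT, inner_self_eq_norm_sq_to_K]
        push_cast; rfl
      rw [Complex.ofReal_inj.1 h1, measure_compl (hle s hs) (measure_ne_top _ _), h, huniv,
        ENNReal.ofReal_sub _ (by positivity)]
    · intro α hd hα h
      choose T hT h using h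
      have hreal : ∀ n v, (μ v).real (α n) = ‖T n v‖ ^ 2 := fun n v => by
        rw [Measure.real, h, ENNReal.toReal_ofReal (by positivity)]
      obtain ⟨P, hP, hs⟩ := exists_isStarProjection_hasSum hT (fun m n hmn => by
        ext v
        have h1 : T n (T n v) = T n v :=
          congrArg (fun S : H →L[ℂ] H => S v) (hT n).isIdempotentElem
        have h2 : (μ (T n v)).real (α m ∪ α n) ≤ (μ (T n v)).real Set.univ :=
          measureReal_mono (Set.subset_univ _)
        rw [measureReal_union (hd hmn) (hle _ (hα n)), hreal, hreal, h1, Measure.real, huniv,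
          ENNReal.toReal_ofReal (by positivity)] at h2
        have h3 : ‖T m (T n v)‖ ^ 2 = 0 := le_antisymm (by linarith) (by positivity)
        simpa using h3)
      refine ⟨P, hP, fun v => ?_⟩
      rw [measure_iUnion hd fun n => hle _ (hα n), ← (hs v).tsum_eq,
        ENNReal.ofReal_tsum_of_nonneg (fun _ => by positivity) (hs v).summable]
      simp only [h]

/-- The spectral measure of a representation of `C(K)`, on the `σ`-field generated by the clopen
sets. -/
theorem exists_of_representation [m : MeasurableSpace K]
    (hm : m = .generateFrom {s : Set K | IsClopen s}) (ρ : C(K, ℂ) →⋆ₐ[ℂ] (H →L[ℂ] H)) :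
    ∃ E : ResolutionOfIdentity H K, ∀ s (hs : IsClopen s), E s = ρ (clopenIndicator hs) := by
  obtain ⟨μ, huniv, hclopen, hμ⟩ :=
    @exists_measures_of_representation H _ _ _ K _ _ _ (borel K)
      (@BorelSpace.mk K _ (borel K) rfl) ρ
  have hle : m ≤ borel K :=
    hm ▸ MeasurableSpace.generateFrom_le fun s hs => .basic s hs.isOpen
  obtain ⟨E, hE⟩ := exists_of_measures (fun v => (μ v).trim hle)
    (fun v => by rw [trim_measurableSet_eq hle .univ, huniv])
    (fun s hs => by
      obtain ⟨T, hT, h⟩ := hμ s (hm ▸ hs)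
      exact ⟨T, hT, fun v => by rw [trim_measurableSet_eq hle hs, h]⟩)
  refine ⟨E, fun s hs => eq_of_inner_self fun v => ?_⟩
  have hms : MeasurableSet s := by rw [hm]; exact .basic s hs
  have := hE s hms v
  rw [trim_measurableSet_eq hle hms, (hclopen s hs).2,
    ENNReal.ofReal_eq_ofReal_iff (by positivity) (by positivity)] at this
  rw [E.inner_apply_self hms, inner_self_of_isStarProjection (hclopen s hs).1, this]

end Representation

end ResolutionOfIdentity

/-! ### Existence, uniqueness and carriers of the joint resolution of the identity -/

universe u

namespace ResolutionOfIdentity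

section Joint

variable {H : Type u} [NormedAddCommGroup H] [InnerProductSpace ℂ H] [CompleteSpace H]

open WeakDual in
/-- A commuting family of projections has a joint spectral measure: one resolution of the identity
takes all of them as values. Here `K` is the character space of the commutative C⋆-algebra that the
projections generate, and `U p` is the set of the characters with value `1` at `p`. -/
theorem exists_of_commuting_projections (S : Set (H →L[ℂ] H)) (hS : ∀ p ∈ S, IsStarProjection p)
    (hcomm : ∀ p ∈ S, ∀ q ∈ S, p * q = q * p) :
    ∃ (K : Type u) (_ : MeasurableSpace K) (F : ResolutionOfIdentity H K)
      (U : (H →L[ℂ] H) → Set K), ∀ p ∈ S, MeasurableSet (U p) ∧ F (U p) = p := by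
  classical
  let A := (StarAlgebra.adjoin ℂ S).topologicalClosure
  have hcl : IsClosed (A : Set (H →L[ℂ] H)) := StarSubalgebra.isClosed_topologicalClosure _
  have hmul : IsMulCommutative (StarAlgebra.adjoin ℂ S) :=
    StarAlgebra.isMulCommutative_adjoin ℂ hcomm fun p hp q hq => by
      rw [(hS q hq).isSelfAdjoint.star_eq, hcomm p hp q hq]
  let _ : CommCStarAlgebra A :=
    { (inferInstance : CStarAlgebra A) with
      mul_comm := ((StarAlgebra.adjoin ℂ S).commRingTopologicalClosure
        fun x y => hmul.is_comm.comm x y).mul_comm }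
  let K := characterSpace ℂ A
  let ρ : C(K, ℂ) →⋆ₐ[ℂ] (H →L[ℂ] H) :=
    A.subtype.comp ((gelfandStarTransform A).symm : C(K, ℂ) →⋆ₐ[ℂ] A)
  let m : MeasurableSpace K := .generateFrom {s : Set K | IsClopen s}
  obtain ⟨F, hF⟩ := exists_of_representation (K := K) rfl ρ
  have hSA : ∀ p ∈ S, p ∈ A := fun p hp =>
    StarSubalgebra.le_topologicalClosure _ (StarAlgebra.subset_adjoin ℂ S hp)
  refine ⟨↥K, m, F, fun p => {χ | ∃ h : p ∈ A, χ ⟨p, h⟩ = 1}, fun p hp => ?_⟩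
  let a : A := ⟨p, hSA p hp⟩
  have hset : {χ : K | ∃ h : p ∈ A, χ ⟨p, h⟩ = 1} = {χ : K | χ a = 1} := by
    ext χ
    exact ⟨fun h => h.2, fun h => ⟨hSA p hp, h⟩⟩
  have h01 : ∀ χ : K, χ a = 0 ∨ χ a = 1 := by
    intro χ
    have : a * a = a := Subtype.ext (hS p hp).isIdempotentElem
    have h : IsIdempotentElem (χ a) := by rw [IsIdempotentElem, ← map_mul, this]
    exact IsIdempotentElem.iff_eq_zero_or_one.1 h
  have hcont : Continuous fun χ : K => χ a := (gelfandTransform ℂ A a).continuous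
  have hclopen : IsClopen {χ : K | χ a = 1} := by
    refine ⟨isClosed_eq hcont continuous_const, ?_⟩
    have : {χ : K | χ a = 1} = {χ : K | χ a ≠ 0} := by
      ext χ
      rcases h01 χ with h | h <;> simp [h]
    rw [this]
    exact isOpen_ne_fun hcont continuous_const
  beta_reduce
  rw [hset]
  refine ⟨.basic _ hclopen, ?_⟩
  rw [hF _ hclopen]
  have : clopenIndicator hclopen = gelfandStarTransform A a := by
    ext χ
    rw [gelfandStarTransform_apply_apply]
    rcases h01 χ with h | h <;> simp [clopenIndicator, h]
  rw [this]
  change (((gelfandStarTransform A).symm (gelfandStarTransform A a) : A) : H →L[ℂ] H) = p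
  rw [StarAlgEquiv.symm_apply_apply]

/-- A nonempty standard Borel space is a measurable retract of the Cantor space. -/
lemma exists_retract_cantor (R : Type*) [MeasurableSpace R] [StandardBorelSpace R] [Nonempty R] :
    ∃ (φ : R → ℕ → Bool) (ψ : (ℕ → Bool) → R), Measurable φ ∧ Measurable ψ ∧ ∀ r, ψ (φ r) = r := by
  have h : MeasurableEmbedding (MeasurableSpace.mapNatBool R) :=
    (MeasurableSpace.measurable_mapNatBool R).measurableEmbedding
      (MeasurableSpace.injective_mapNatBool R)
  obtain ⟨ψ, hψ, hψ'⟩ := h.exists_measurable_extend measurable_id fun _ => inferInstance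
  exact ⟨_, ψ, h.measurable, hψ, fun r => congrFun hψ' r⟩

/-- The product `σ`-field is generated by the preimages under the coordinate maps. -/
lemma pi_eq_generateFrom {X : Type*} {R : X → Type*} [∀ x, MeasurableSpace (R x)] :
    MeasurableSpace.pi (X := R) = MeasurableSpace.generateFrom
      {s | ∃ x, ∃ t : Set (R x), MeasurableSet t ∧ (fun u : ∀ x, R x => u x) ⁻¹' t = s} := by
  apply le_antisymm
  · refine iSup_le fun x => ?_
    rintro _ ⟨t, ht, rfl⟩
    exact .basic _ ⟨x, t, ht, rfl⟩
  · refine MeasurableSpace.generateFrom_le ?_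
    rintro _ ⟨x, t, ht, rfl⟩
    exact measurable_pi_apply x ht

/-- The `σ`-field of the Cantor space is generated by the sets `{w | w n = true}`. -/
lemma cantor_eq_generateFrom :
    (inferInstance : MeasurableSpace (ℕ → Bool)) =
      .generateFrom {s | ∃ n : ℕ, s = {w : ℕ → Bool | w n = true}} := by
  apply le_antisymm
  · refine iSup_le fun n => ?_
    rw [← measurable_iff_comap_le]
    exact @measurable_to_bool _ (_) _ (.basic _ ⟨n, rfl⟩)
  · refine MeasurableSpace.generateFrom_le ?_
    rintro _ ⟨n, rfl⟩
    exact measurable_pi_apply (X := fun _ : ℕ => Bool) n (measurableSet_singleton true)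

variable {X : Type*} {R : X → Type*} [∀ x, MeasurableSpace (R x)]
  {E : ∀ x, ResolutionOfIdentity H (R x)} {hE : IsCommutingFamily E}

/-- A joint resolution of the identity is one whose coordinate marginals are the given ones. -/
lemma isJoint_iff {J : ResolutionOfIdentity H (∀ x, R x)} :
    IsJoint E hE J ↔ ∀ x (t : Set (R x)), MeasurableSet t →
      J ((fun u : ∀ x, R x => u x) ⁻¹' t) = E x t := by
  classical
  constructor
  · intro h x t ht
    have hδ : ∀ y, MeasurableSet (Function.update (fun y => (Set.univ : Set (R y))) x t y) := by
      intro y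
      by_cases hy : y = x
      · subst hy; simpa using ht
      · simp [hy]
    have := h {x} (Function.update (fun _ => Set.univ) x t) hδ
    refine Eq.trans ?_ (this.trans ((Finset.noncommProd_singleton _ _).trans
      (by rw [Function.update_self])))
    congr 1
    ext u
    simp only [cylinder, Set.mem_preimage, Set.mem_univ_pi, Subtype.forall, Finset.mem_singleton,
      Finset.restrict]
    exact ⟨fun hu a b => by subst b; simpa using hu, fun hu => by simpa using hu x rfl⟩
  · intro h Q δ hδ
    have hcyl : ∀ Q : Finset X, cylinder Q (Set.univ.pi fun y : Q => δ y) =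
        {u : ∀ x, R x | ∀ x ∈ Q, u x ∈ δ x} := by
      intro Q
      ext u
      simp [cylinder, Finset.restrict]
    have hmeas : ∀ Q : Finset X, MeasurableSet {u : ∀ x, R x | ∀ x ∈ Q, u x ∈ δ x} := by
      intro Q
      rw [← hcyl]
      exact MeasurableSet.cylinder Q (.univ_pi fun y => hδ y)
    rw [hcyl]
    induction Q using Finset.induction_on with
    | empty =>
      refine Eq.trans ?_ (Finset.noncommProd_empty _ _).symm
      simp [J.univ']
    | insert x Q hx ih =>
      refine Eq.trans ?_ (Finset.noncommProd_insert_of_notMem _ _ _ _ hx).symm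
      refine Eq.trans ?_ (congrArg (E x (δ x) * ·) ih)
      rw [← h x _ (hδ x), ← J.inter' _ _ (measurable_pi_apply x (hδ x)) (hmeas Q)]
      congr 1
      ext u
      simp

/-- A joint resolution of the identity is unique. -/
lemma IsJoint.unique {J J' : ResolutionOfIdentity H (∀ x, R x)} (h : IsJoint E hE J)
    (h' : IsJoint E hE J') : J = J' := by
  refine ext_of_generateFrom pi_eq_generateFrom ?_
  rintro _ ⟨x, t, ht, rfl⟩
  rw [isJoint_iff.1 h x t ht, isJoint_iff.1 h' x t ht]

/-- Existence of the joint resolution of the identity: realise all the projections at once as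
values of one resolution of the identity `F` on a space `K`. Each bit of the Cantor code of the
coordinate in `R x` is the indicator of a measurable subset of `K`, which gives a measurable map
from `K` to the product along which `F` is pushed forward. -/
theorem exists_isJoint [∀ x, StandardBorelSpace (R x)] (hE : IsCommutingFamily E) :
    ∃ J : ResolutionOfIdentity H (∀ x, R x), IsJoint E hE J := by
  classical
  -- a factor `R x` can be empty only if `H` is trivial, and then there is nothing to construct
  rcases subsingleton_or_nontrivial H with hH | hH
  · have hop : ∀ S T : H →L[ℂ] H, S = T := fun S T => Subsingleton.elim S T
    refine ⟨⟨fun _ => 0, fun _ _ => rfl, fun _ _ => hop _ _, fun _ _ _ _ => hop _ _,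
      fun _ _ _ _ => hop _ _, hop _ _, rfl, fun α _ _ x y => ?_, fun _ _ => .zero _⟩,
      fun _ _ _ => hop _ _⟩
    simp
  have hne : ∀ x, Nonempty (R x) := by
    intro x
    by_contra h
    rw [not_nonempty_iff] at h
    have h1 := (E x).univ'
    rw [Set.univ_eq_empty_iff.2 h, (E x).empty'] at h1
    exact zero_ne_one h1
  obtain ⟨K, _, F, U, hU⟩ := exists_of_commuting_projections
    {p : H →L[ℂ] H | ∃ x, ∃ t : Set (R x), MeasurableSet t ∧ E x t = p}
    (by rintro _ ⟨x, t, ht, rfl⟩; exact (E x).isStarProjection ht)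
    (by rintro _ ⟨x, t, ht, rfl⟩ _ ⟨y, s, hs, rfl⟩; exact hE x y t s ht hs)
  choose φ ψ hφ hψ hψφ using fun x => exists_retract_cantor (R x)
  have hbit : ∀ x n, MeasurableSet {r : R x | φ x r n = true} := fun x n =>
    (measurable_pi_iff.1 (hφ x) n) (measurableSet_singleton true)
  -- the bits of the Cantor code of the `x`-th coordinate of a point of `K`
  let c : ∀ x, K → ℕ → Bool := fun x k n => decide (k ∈ U (E x {r | φ x r n = true}))
  have hc : ∀ x, Measurable (c x) := fun x => measurable_pi_iff.2 fun n =>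
    measurable_to_bool (by
      convert! (hU _ ⟨x, _, hbit x n, rfl⟩).1
      ext k; simp [c])
  -- the bit sequences under `F` and under `E x` have the same distribution
  have hdist : ∀ x (s : Set (ℕ → Bool)), MeasurableSet s → F (c x ⁻¹' s) = E x (φ x ⁻¹' s) := by
    intro x s hs
    obtain ⟨F', hF'⟩ := F.exists_map (hc x)
    obtain ⟨E', hE'⟩ := (E x).exists_map (hφ x)
    rw [← hF' s hs, ← hE' s hs]
    congr 1
    refine ext_of_generateFrom (C := {s | ∃ n : ℕ, s = {w : ℕ → Bool | w n = true}}) ?_ ?_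
    · exact cantor_eq_generateFrom
    · rintro _ ⟨n, rfl⟩
      have hm : MeasurableSet {w : ℕ → Bool | w n = true} :=
        measurable_pi_apply (X := fun _ : ℕ => Bool) n (measurableSet_singleton true)
      rw [hF' _ hm, hE' _ hm]
      refine Eq.trans ?_ (hU _ ⟨x, _, hbit x n, rfl⟩).2
      congr 1
      ext k; simp [c]
  obtain ⟨J, hJ⟩ := F.exists_map (g := fun k x => ψ x (c x k))
    (measurable_pi_iff.2 fun x => (hψ x).comp (hc x))
  refine ⟨J, isJoint_iff.2 fun x t ht => ?_⟩
  rw [hJ _ (measurable_pi_apply x ht)]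
  refine (hdist x _ (hψ x ht)).trans ?_
  congr 1
  ext r
  simp [hψφ]

/-- The joint resolution of the identity is carried by every cylinder over the product of finitely
many supports. -/
lemma IsJoint.apply_suppCylinder [∀ x, TopologicalSpace (R x)]
    [∀ x, SecondCountableTopology (R x)] [∀ x, BorelSpace (R x)]
    {J : ResolutionOfIdentity H (∀ x, R x)} (hJ : IsJoint E hE J) (Q : Finset X) :
    MeasurableSet (suppCylinder E Q) ∧ J (suppCylinder E Q) = 1 := by
  have hm : ∀ x, MeasurableSet (E x).supp := fun x => (E x).isClosed_supp.measurableSet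
  refine ⟨MeasurableSet.cylinder Q (.univ_pi fun y => hm y), ?_⟩
  refine (hJ Q (fun x => (E x).supp) hm).trans ?_
  exact (Finset.noncommProd_eq_pow_card _ _ _ 1 fun x _ => (E x).apply_supp).trans (one_pow _)

end Joint

end ResolutionOfIdentity

/-! ### Integrals of bounded measurable functions -/

namespace ResolutionOfIdentity

section Integral

variable {H : Type*} [NormedAddCommGroup H] [InnerProductSpace ℂ H] [CompleteSpace H]
  {Z : Type*} [MeasurableSpace Z] (E : ResolutionOfIdentity H Z)

lemma inner_simpleIntegral (s : SimpleFunc Z ℂ) (v : H) :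
    inner ℂ v (E.simpleIntegral s v) = ∫ z, s z ∂E.diagMeasure v := by
  rw [SimpleFunc.integral_eq_sum s (s.integrable_of_isFiniteMeasure), simpleIntegral,
    _root_.sum_apply, inner_sum]
  refine Finset.sum_congr rfl fun c _ => ?_
  have hm : MeasurableSet (s ⁻¹' {c}) := s.measurableSet_fiber c
  rw [smul_apply, inner_smul_right, E.inner_apply_self hm, E.diagMeasure_real hm, mul_comm]
  rfl

/-- A simple function integrates to an operator given by its quadratic form. -/
lemma simpleIntegral_eq {s : SimpleFunc Z ℂ} {T : H →L[ℂ] H}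
    (h : ∀ v, inner ℂ v (T v) = ∫ z, s z ∂E.diagMeasure v) : E.simpleIntegral s = T :=
  eq_of_inner_self fun v => by rw [inner_simpleIntegral, h]

lemma simpleIntegral_add (s t : SimpleFunc Z ℂ) :
    E.simpleIntegral (s + t) = E.simpleIntegral s + E.simpleIntegral t :=
  E.simpleIntegral_eq fun v => by
    rw [add_apply, inner_add_right, inner_simpleIntegral, inner_simpleIntegral,
      ← integral_add s.integrable_of_isFiniteMeasure t.integrable_of_isFiniteMeasure]
    rfl

lemma simpleIntegral_sub (s t : SimpleFunc Z ℂ) :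
    E.simpleIntegral (s - t) = E.simpleIntegral s - E.simpleIntegral t :=
  E.simpleIntegral_eq fun v => by
    rw [sub_apply, inner_sub_right, inner_simpleIntegral, inner_simpleIntegral,
      ← integral_sub s.integrable_of_isFiniteMeasure t.integrable_of_isFiniteMeasure]
    rfl

lemma simpleIntegral_eq_smul {s : SimpleFunc Z ℂ} {c : ℂ} {A : Set Z} (hA : MeasurableSet A)
    (h : ∀ z, s z = A.indicator (fun _ => c) z) : E.simpleIntegral s = c • E A :=
  E.simpleIntegral_eq fun v => by
    simp only [h]
    rw [integral_indicator_const _ hA, E.diagMeasure_real hA, smul_apply, inner_smul_right,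
      E.inner_apply_self hA, mul_comm]
    rfl

lemma simpleIntegral_mul (s t : SimpleFunc Z ℂ) :
    E.simpleIntegral (s * t) = E.simpleIntegral s * E.simpleIntegral t := by
  classical
  induction s using SimpleFunc.induction with
  | add _ hf hg => rw [add_mul, simpleIntegral_add, hf, hg, simpleIntegral_add, add_mul]
  | const c hA =>
    rename_i A
    induction t using SimpleFunc.induction with
    | add _ hf hg => rw [mul_add, simpleIntegral_add, hf, hg, simpleIntegral_add, mul_add]
    | const d hB =>
      rename_i B
      rw [E.simpleIntegral_eq_smul (c := c * d) (hA.inter hB), E.simpleIntegral_eq_smul (c := c) hA,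
        E.simpleIntegral_eq_smul (c := d) hB, E.inter' A B hA hB, smul_mul_smul_comm]
      all_goals
        intro z
        by_cases h1 : z ∈ A <;> by_cases h2 : z ∈ B <;> simp [h1, h2]

lemma simpleIntegral_star (s : SimpleFunc Z ℂ) :
    E.simpleIntegral (s.map (starRingEnd ℂ)) = star (E.simpleIntegral s) :=
  E.simpleIntegral_eq fun v => by
    rw [ContinuousLinearMap.star_eq_adjoint, ContinuousLinearMap.adjoint_inner_right,
      ← inner_conj_symm, inner_simpleIntegral, ← integral_conj]
    rfl

lemma norm_sq_simpleIntegral_apply (s : SimpleFunc Z ℂ) (v : H) :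
    ‖E.simpleIntegral s v‖ ^ 2 = ∫ z, ‖s z‖ ^ 2 ∂E.diagMeasure v := by
  have h : ((‖E.simpleIntegral s v‖ ^ 2 : ℝ) : ℂ) =
      ((∫ z, ‖s z‖ ^ 2 ∂E.diagMeasure v : ℝ) : ℂ) := by
    have h1 := inner_self_eq_norm_sq_to_K (𝕜 := ℂ) (E.simpleIntegral s v)
    rw [← ContinuousLinearMap.adjoint_inner_right, ← ContinuousLinearMap.star_eq_adjoint,
      ← simpleIntegral_star, ← mul_apply_eq_comp, ← simpleIntegral_mul, inner_simpleIntegral] at h1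
    rw [← integral_complex_ofReal]
    push_cast
    refine h1.symm.trans (integral_congr_ae (.of_forall fun z => ?_))
    exact RCLike.conj_mul (s z)
  exact_mod_cast h

lemma norm_simpleIntegral_le {s : SimpleFunc Z ℂ} {C : ℝ} (hC : 0 ≤ C) (h : ∀ z, ‖s z‖ ≤ C) :
    ‖E.simpleIntegral s‖ ≤ C := by
  refine ContinuousLinearMap.opNorm_le_bound _ hC fun v => ?_
  rw [← pow_le_pow_iff_left₀ (norm_nonneg _) (by positivity) two_ne_zero,
    norm_sq_simpleIntegral_apply]
  calc ∫ z, ‖s z‖ ^ 2 ∂E.diagMeasure v ≤ ∫ _, C ^ 2 ∂E.diagMeasure v := by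
        refine integral_mono_of_nonneg (.of_forall fun _ => by positivity) (integrable_const _)
          (.of_forall fun z => ?_)
        exact pow_le_pow_left₀ (norm_nonneg _) (h z) 2
    _ = (C * ‖v‖) ^ 2 := by
        rw [integral_const, E.diagMeasure_real .univ, E.univ', one_apply_eq_self, smul_eq_mul]
        ring

/-- Bounded measurable functions are uniform limits of simple functions. -/
lemma exists_simpleFunc_approx {g : Z → ℂ} (hg : Measurable g) {C : ℝ} (hC : ∀ z, ‖g z‖ ≤ C)
    {ε : ℝ} (hε : 0 < ε) : ∃ s : SimpleFunc Z ℂ, ∀ z, dist (s z) (g z) < ε := by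
  obtain ⟨t, ht⟩ := (isCompact_closedBall (0 : ℂ) C).elim_finite_subcover
    (fun k : ℕ => Metric.ball (TopologicalSpace.denseSeq ℂ k) ε) (fun _ => Metric.isOpen_ball)
    (fun w _ => by
      obtain ⟨_, hw, k, rfl⟩ := Metric.dense_iff.1 (TopologicalSpace.denseRange_denseSeq ℂ) w ε hε
      exact Set.mem_iUnion.2 ⟨k, Metric.mem_ball_comm.1 hw⟩)
  refine ⟨(SimpleFunc.nearestPt (TopologicalSpace.denseSeq ℂ) (t.sup id)).comp g hg, fun z => ?_⟩
  obtain ⟨k, hk, hz⟩ := Set.mem_iUnion₂.1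
    (ht (show g z ∈ Metric.closedBall 0 C by simpa using hC z))
  have h1 := SimpleFunc.edist_nearestPt_le (TopologicalSpace.denseSeq ℂ) (g z)
    (Finset.le_sup (f := id) hk)
  rw [edist_dist, edist_dist, ENNReal.ofReal_le_ofReal_iff dist_nonneg] at h1
  rw [Metric.mem_ball, dist_comm] at hz
  exact h1.trans_lt hz

/-- Bounded measurable complex functions. -/
def BoundedMeasurable (g : Z → ℂ) : Prop := Measurable g ∧ ∃ C, ∀ z, ‖g z‖ ≤ C

namespace BoundedMeasurable

variable {g h : Z → ℂ}

lemma integrable (hg : BoundedMeasurable g) (μ : Measure Z) [IsFiniteMeasure μ] :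
    Integrable g μ := by
  obtain ⟨hg, C, hC⟩ := hg
  exact .of_bound hg.aestronglyMeasurable C (.of_forall hC)

lemma sub (hg : BoundedMeasurable g) (hh : BoundedMeasurable h) :
    BoundedMeasurable (g - h) := by
  obtain ⟨hg, C, hC⟩ := hg
  obtain ⟨hh, D, hD⟩ := hh
  exact ⟨hg.sub hh, C + D, fun z => (norm_sub_le _ _).trans (add_le_add (hC z) (hD z))⟩

lemma mul (hg : BoundedMeasurable g) (hh : BoundedMeasurable h) :
    BoundedMeasurable (g * h) := by
  obtain ⟨hg, C, hC⟩ := hg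
  obtain ⟨hh, D, hD⟩ := hh
  refine ⟨hg.mul hh, C * D, fun z => (norm_mul_le _ _).trans ?_⟩
  exact mul_le_mul (hC z) (hD z) (norm_nonneg _) ((norm_nonneg _).trans (hC z))

lemma const (c : ℂ) : BoundedMeasurable (fun _ : Z => c) :=
  ⟨measurable_const, ‖c‖, fun _ => le_rfl⟩

lemma star (hg : BoundedMeasurable g) : BoundedMeasurable (star g) := by
  obtain ⟨hg, C, hC⟩ := hg
  exact ⟨continuous_star.measurable.comp hg, C, fun z => by simpa using hC z⟩

lemma trunc {f : Z → ℂ} (hf : Measurable f) (n : ℕ) :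
    BoundedMeasurable (ResolutionOfIdentity.trunc f n) := by
  refine ⟨hf.indicator (measurableSet_le hf.norm measurable_const), n, fun z => ?_⟩
  rw [ResolutionOfIdentity.trunc, Set.indicator]
  split_ifs with h
  · exact h
  · simp

/-- A bounded measurable function is the uniform limit of a sequence of simple functions. -/
lemma exists_tendstoUniformly (hg : BoundedMeasurable g) :
    ∃ s : ℕ → SimpleFunc Z ℂ, TendstoUniformly (fun n z => s n z) g atTop := by
  obtain ⟨hg, C, hC⟩ := hg
  choose s hs using fun n : ℕ => exists_simpleFunc_approx hg hC (Nat.one_div_pos_of_nat (n := n))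
  refine ⟨s, Metric.tendstoUniformly_iff.2 fun ε hε => ?_⟩
  filter_upwards [(tendsto_one_div_add_atTop_nhds_zero_nat (𝕜 := ℝ)).eventually_lt_const hε]
    with n hn z
  rw [dist_comm]
  exact (hs n z).trans hn

end BoundedMeasurable

/-- The operator norm limit that defines `boundedIntegral` exists, and its quadratic form is the
integral with respect to the scalar measures. -/
lemma boundedIntegral_spec {g : Z → ℂ} (hg : BoundedMeasurable g) :
    (∀ s : ℕ → SimpleFunc Z ℂ, TendstoUniformly (fun n z => s n z) g atTop →
      Tendsto (fun n => E.simpleIntegral (s n)) atTop (𝓝 (E.boundedIntegral g))) ∧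
    ∀ v, inner ℂ v (E.boundedIntegral g v) = ∫ z, g z ∂E.diagMeasure v := by
  have hbasis := ((UniformFun.hasBasis_nhds_of_basis Z ℂ (UniformFun.ofFun g)
    Metric.uniformity_basis_dist).comap
      (fun s : SimpleFunc Z ℂ => UniformFun.ofFun (s : Z → ℂ)))
  set l : Filter (SimpleFunc Z ℂ) := comap (fun s : SimpleFunc Z ℂ => UniformFun.ofFun (s : Z → ℂ))
    (𝓝 (UniformFun.ofFun g : Z →ᵤ ℂ)) with hl
  have hev : ∀ ε : ℝ, 0 < ε → ∀ᶠ s in l, ∀ z, dist (g z) (s z) < ε := fun ε hε =>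
    hbasis.mem_of_mem hε
  have hne : l.NeBot := hbasis.neBot_iff.2 fun {ε} hε => by
    obtain ⟨hgm, C, hC⟩ := hg
    obtain ⟨s, hs⟩ := exists_simpleFunc_approx hgm hC hε
    refine ⟨s, fun z => ?_⟩
    change dist (g z) (s z) < ε
    rw [dist_comm]
    exact hs z
  have hcauchy : Cauchy (map E.simpleIntegral l) := by
    refine Metric.cauchy_iff.2 ⟨hne.map _, fun ε hε => ?_⟩
    refine ⟨_, image_mem_map (hev (ε / 4) (by positivity)), ?_⟩
    rintro _ ⟨s, hs, rfl⟩ _ ⟨t, ht, rfl⟩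
    rw [dist_eq_norm, ← simpleIntegral_sub]
    refine (E.norm_simpleIntegral_le (C := ε / 2) (by positivity) fun z => ?_).trans_lt
      (by linarith)
    have h1 := hs z
    have h2 := ht z
    have h3 := dist_triangle_left (s z) (t z) (g z)
    rw [SimpleFunc.coe_sub, Pi.sub_apply, ← dist_eq_norm]
    linarith
  obtain ⟨T, hT⟩ := CompleteSpace.complete hcauchy
  have hlim : Tendsto E.simpleIntegral l (𝓝 (E.boundedIntegral g)) :=
    tendsto_nhds_limUnder ⟨T, hT⟩
  have hseq : ∀ s : ℕ → SimpleFunc Z ℂ, TendstoUniformly (fun n z => s n z) g atTop →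
      Tendsto (fun n => E.simpleIntegral (s n)) atTop (𝓝 (E.boundedIntegral g)) := fun s hs =>
    hlim.comp (tendsto_comap_iff.2 (UniformFun.tendsto_iff_tendstoUniformly.2 hs))
  refine ⟨hseq, fun v => ?_⟩
  obtain ⟨s, hs⟩ := hg.exists_tendstoUniformly
  have h1 : Tendsto (fun n => inner ℂ v (E.simpleIntegral (s n) v)) atTop
      (𝓝 (inner ℂ v (E.boundedIntegral g v))) :=
    ((innerSL ℂ v).continuous.tendsto _).comp
      (((ContinuousLinearMap.apply ℂ H v).continuous.tendsto _).comp (hseq s hs))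
  simp only [inner_simpleIntegral] at h1
  refine tendsto_nhds_unique h1 ?_
  obtain ⟨hgm, C, hC⟩ := hg
  have hev := Metric.tendstoUniformly_iff.1 hs 1 one_pos
  refine tendsto_integral_filter_of_dominated_convergence (fun _ => C + 1)
    (.of_forall fun n => (s n).measurable.aestronglyMeasurable)
    (hev.mono fun n hn => .of_forall fun z => ?_) (integrable_const _)
    (.of_forall fun z => hs.tendsto_at z)
  have h2 := hn z
  have h3 := norm_sub_norm_le (s n z) (g z)
  rw [dist_comm, dist_eq_norm] at h2
  linarith [hC z]

variable {E} {g h : Z → ℂ}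

lemma inner_boundedIntegral (hg : BoundedMeasurable g) (v : H) :
    inner ℂ v (E.boundedIntegral g v) = ∫ z, g z ∂E.diagMeasure v :=
  (E.boundedIntegral_spec hg).2 v

/-- The integral of a bounded measurable function is determined by its quadratic form. -/
lemma boundedIntegral_eq (hg : BoundedMeasurable g) {T : H →L[ℂ] H}
    (h : ∀ v, inner ℂ v (T v) = ∫ z, g z ∂E.diagMeasure v) : E.boundedIntegral g = T :=
  eq_of_inner_self fun v => by rw [inner_boundedIntegral hg, h]

lemma boundedIntegral_sub (hg : BoundedMeasurable g) (hh : BoundedMeasurable h) :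
    E.boundedIntegral (g - h) = E.boundedIntegral g - E.boundedIntegral h :=
  boundedIntegral_eq (hg.sub hh) fun v => by
    rw [sub_apply, inner_sub_right, inner_boundedIntegral hg, inner_boundedIntegral hh,
      ← integral_sub (hg.integrable _) (hh.integrable _)]
    rfl

lemma boundedIntegral_star (hg : BoundedMeasurable g) :
    E.boundedIntegral (star g) = star (E.boundedIntegral g) :=
  boundedIntegral_eq hg.star fun v => by
    rw [ContinuousLinearMap.star_eq_adjoint, ContinuousLinearMap.adjoint_inner_right,
      ← inner_conj_symm, inner_boundedIntegral hg, ← integral_conj]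
    rfl

lemma boundedIntegral_const (c : ℂ) : E.boundedIntegral (fun _ => c) = c • 1 :=
  boundedIntegral_eq (.const c) fun v => by
    rw [integral_const, E.diagMeasure_real .univ, E.univ', one_apply_eq_self, smul_apply,
      one_apply_eq_self, inner_smul_right, inner_self_eq_norm_sq_to_K, mul_comm, Complex.real_smul]
    push_cast; rfl

/-- Functions that agree on a set of full spectral measure have the same integral. -/
lemma boundedIntegral_congr {S : Set Z} (hS : MeasurableSet S) (hS1 : E S = 1)
    (hg : BoundedMeasurable g) (hh : BoundedMeasurable h) (hgh : Set.EqOn g h S) :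
    E.boundedIntegral g = E.boundedIntegral h :=
  boundedIntegral_eq hg fun v => by
    rw [inner_boundedIntegral hh]
    refine integral_congr_ae ?_
    have h0 : ∀ᵐ z ∂E.diagMeasure v, z ∈ S :=
      measure_eq_zero_iff_ae_notMem.1 ((E.apply_eq_one_iff hS).1 hS1 v) |>.mono fun z hz => by
        simpa using hz
    exact h0.mono fun z hz => (hgh hz).symm

lemma boundedIntegral_mul (hg : BoundedMeasurable g) (hh : BoundedMeasurable h) :
    E.boundedIntegral (g * h) = E.boundedIntegral g * E.boundedIntegral h := by
  obtain ⟨s, hs⟩ := hg.exists_tendstoUniformly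
  obtain ⟨t, ht⟩ := hh.exists_tendstoUniformly
  have hst : TendstoUniformly (fun n z => (s n * t n) z) (g * h) atTop := by
    obtain ⟨-, C, hC⟩ := hg
    obtain ⟨-, D, hD⟩ := hh
    rw [Metric.tendstoUniformly_iff] at hs ht ⊢
    intro ε hε
    have hM : 0 < |C| + |D| + 1 := by positivity
    have hδ : 0 < min 1 (ε / (|C| + |D| + 1)) := by positivity
    filter_upwards [hs _ hδ, ht _ hδ] with n hn hn' z
    have h1 := hn z
    have h2 := hn' z
    rw [dist_eq_norm] at h1 h2 ⊢
    have h4 : ‖t n z‖ ≤ |D| + 1 := by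
      have h3 := norm_sub_norm_le (t n z) (h z)
      rw [norm_sub_rev] at h3
      linarith [hD z, le_abs_self D, h2.trans_le (min_le_left _ _)]
    have h5 : ‖g z‖ ≤ |C| := (hC z).trans (le_abs_self C)
    have h6 : (g * h) z - (s n * t n) z = g z * (h z - t n z) + (g z - s n z) * t n z := by
      simp only [Pi.mul_apply, SimpleFunc.coe_mul]; ring
    rw [h6]
    have h7 : min 1 (ε / (|C| + |D| + 1)) * (|C| + |D| + 1) ≤ ε := by
      calc _ ≤ ε / (|C| + |D| + 1) * (|C| + |D| + 1) :=
            mul_le_mul_of_nonneg_right (min_le_right _ _) hM.le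
        _ = ε := div_mul_cancel₀ _ hM.ne'
    calc _ ≤ ‖g z‖ * ‖h z - t n z‖ + ‖g z - s n z‖ * ‖t n z‖ :=
          (norm_add_le _ _).trans (by rw [norm_mul, norm_mul])
      _ ≤ |C| * min 1 (ε / (|C| + |D| + 1)) + ‖g z - s n z‖ * (|D| + 1) := by gcongr
      _ < |C| * min 1 (ε / (|C| + |D| + 1)) + min 1 (ε / (|C| + |D| + 1)) * (|D| + 1) := by
          gcongr
      _ ≤ ε := by linarith
  have h1 := (E.boundedIntegral_spec (hg.mul hh)).1 _ hst
  simp only [simpleIntegral_mul] at h1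
  exact tendsto_nhds_unique h1
    (((E.boundedIntegral_spec hg).1 s hs).mul ((E.boundedIntegral_spec hh).1 t ht))

lemma norm_sq_boundedIntegral_apply (hg : BoundedMeasurable g) (v : H) :
    ‖E.boundedIntegral g v‖ ^ 2 = ∫ z, ‖g z‖ ^ 2 ∂E.diagMeasure v := by
  have h : ((‖E.boundedIntegral g v‖ ^ 2 : ℝ) : ℂ) =
      ((∫ z, ‖g z‖ ^ 2 ∂E.diagMeasure v : ℝ) : ℂ) := by
    have h1 := inner_self_eq_norm_sq_to_K (𝕜 := ℂ) (E.boundedIntegral g v)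
    rw [← ContinuousLinearMap.adjoint_inner_right, ← ContinuousLinearMap.star_eq_adjoint,
      ← boundedIntegral_star hg, ← mul_apply_eq_comp, ← boundedIntegral_mul hg.star hg,
      inner_boundedIntegral (hg.star.mul hg)] at h1
    rw [← integral_complex_ofReal]
    push_cast
    refine h1.symm.trans (integral_congr_ae (.of_forall fun z => ?_))
    exact RCLike.conj_mul (g z)
  exact_mod_cast h

/-- Dominated convergence, in the strong operator topology. -/
lemma tendsto_boundedIntegral {G : ℕ → Z → ℂ} (hG : ∀ n, Measurable (G n))
    (hg : BoundedMeasurable g) {C : ℝ} (hC : ∀ n z, ‖G n z‖ ≤ C)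
    (hlim : ∀ z, Tendsto (fun n => G n z) atTop (𝓝 (g z))) (v : H) :
    Tendsto (fun n => E.boundedIntegral (G n) v) atTop (𝓝 (E.boundedIntegral g v)) := by
  have hGb : ∀ n, BoundedMeasurable (G n) := fun n => ⟨hG n, C, hC n⟩
  rw [tendsto_iff_norm_sub_tendsto_zero]
  have h1 : Tendsto (fun n => ∫ z, ‖(G n - g) z‖ ^ 2 ∂E.diagMeasure v) atTop
      (𝓝 (∫ _, 0 ∂E.diagMeasure v)) := by
    obtain ⟨hgm, D, hD⟩ := hg
    refine tendsto_integral_of_dominated_convergence (fun _ => (C + D) ^ 2)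
      (fun n => (((hG n).sub hgm).norm.pow_const 2).aestronglyMeasurable) (integrable_const _)
      (fun n => .of_forall fun z => ?_) (.of_forall fun z => ?_)
    · rw [norm_pow, norm_norm]
      exact pow_le_pow_left₀ (norm_nonneg _)
        ((norm_sub_le _ _).trans (add_le_add (hC n z) (hD z))) 2
    · have := ((hlim z).sub_const (g z)).norm.pow 2
      simpa using this
  have h2 : ∀ n, ∫ z, ‖(G n - g) z‖ ^ 2 ∂E.diagMeasure v =
      ‖E.boundedIntegral (G n) v - E.boundedIntegral g v‖ ^ 2 := fun n => by
    rw [← norm_sq_boundedIntegral_apply ((hGb n).sub hg), boundedIntegral_sub (hGb n) hg, sub_apply]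
  simp only [h2, integral_zero] at h1
  have := h1.sqrt
  simpa [Real.sqrt_sq (norm_nonneg _)] using this

end Integral

end ResolutionOfIdentity

/-! ### Spectrum and selfadjointness of `f(E)` -/

/-- A symmetric operator `T` for which both `i - T` and `-i - T` are onto is selfadjoint. Density
of the domain is a consequence: if `z = c w - T w` is orthogonal to the domain, then
`0 = ⟪w, z⟫ = c ‖w‖² - ⟪w, T w⟫` with `⟪w, T w⟫` real, so that `w = 0`. -/
lemma LinearPMap.isSelfAdjoint_of_surjective {H : Type*} [NormedAddCommGroup H]
    [InnerProductSpace ℂ H] [CompleteSpace H] {T : H →ₗ.[ℂ] H} (hT : T.IsFormalAdjoint T)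
    (h₁ : ∀ y, ∃ x : T.domain, Complex.I • (x : H) - T x = y)
    (h₂ : ∀ y, ∃ x : T.domain, (-Complex.I) • (x : H) - T x = y) : IsSelfAdjoint T := by
  have hdense : Dense (T.domain : Set H) := by
    rw [Submodule.dense_iff_topologicalClosure_eq_top, Submodule.topologicalClosure_eq_top_iff,
      Submodule.eq_bot_iff]
    intro z hz
    obtain ⟨w, rfl⟩ := h₁ z
    have h3 : inner ℂ (w : H) (Complex.I • (w : H) - T w) = 0 := hz w w.2
    have hreal : (inner ℂ (w : H) (T w)).im = 0 := by
      rw [← Complex.conj_eq_iff_im, inner_conj_symm]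
      exact hT w w
    rw [inner_sub_right, inner_smul_right, inner_self_eq_norm_sq_to_K] at h3
    have h4 := congrArg Complex.im h3
    have h5 : ‖(w : H)‖ ^ 2 = 0 := by
      rw [Complex.sub_im, hreal, Complex.I_mul_im, sub_zero] at h4
      have h6 : (((‖(w : H)‖ : ℝ) : ℂ) ^ 2).re = 0 := h4
      rwa [← Complex.ofReal_pow, Complex.ofReal_re] at h6
    have h6 : w = 0 := by simpa using h5
    simp [h6]
  have hle : T ≤ T.adjoint := LinearPMap.IsFormalAdjoint.le_adjoint hdense hT
  rw [LinearPMap.isSelfAdjoint_def]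
  refine (LinearPMap.eq_of_le_of_domain_eq hle (le_antisymm hle.1 fun y hy => ?_)).symm
  -- for `y` in the domain of `T†` choose `x` with `(i - T) x = (i - T†) y`; then `y - x` is
  -- orthogonal to the range of `-i - T`
  obtain ⟨x, hx⟩ := h₁ (Complex.I • y - T.adjoint ⟨y, hy⟩)
  obtain ⟨u, hu⟩ := h₂ (y - x)
  have hadj : inner ℂ (T.adjoint ⟨y, hy⟩) (u : H) = inner ℂ y (T u) :=
    LinearPMap.adjoint_isFormalAdjoint hdense ⟨y, hy⟩ u
  have hsym := hT x u
  have hx' : T.adjoint ⟨y, hy⟩ - T x = Complex.I • (y - x) := by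
    rw [smul_sub, sub_eq_sub_iff_add_eq_add]
    rw [sub_eq_sub_iff_add_eq_add] at hx
    rw [add_comm, hx]
  have h7 : inner ℂ (y - (x : H)) (y - (x : H)) = 0 := by
    calc inner ℂ (y - (x : H)) (y - (x : H))
        = inner ℂ (y - (x : H)) ((-Complex.I) • (u : H) - T u) := by rw [hu]
      _ = inner ℂ (Complex.I • (y - x)) (u : H) - (inner ℂ y (T u) - inner ℂ (x : H) (T u)) := by
          rw [inner_sub_right, inner_smul_right, inner_smul_left, inner_sub_left (z := T u),
            Complex.conj_I]
      _ = 0 := by rw [← hx', inner_sub_left, hadj, hsym, sub_self]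
  have h8 : y = x := sub_eq_zero.1 (inner_self_eq_zero.1 h7)
  rw [h8]
  exact x.2

namespace ResolutionOfIdentity

section Operator

lemma norm_trunc_le {Z : Type*} (f : Z → ℂ) (n : ℕ) (z : Z) : ‖trunc f n z‖ ≤ ‖f z‖ :=
  norm_indicator_le_norm_self _ _

lemma tendsto_trunc {Z : Type*} (f : Z → ℂ) (z : Z) :
    Tendsto (fun n : ℕ => trunc f n z) atTop (𝓝 (f z)) := by
  refine tendsto_const_nhds.congr' ?_
  filter_upwards [eventually_ge_atTop ⌈‖f z‖⌉₊] with n hn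
  have : ‖f z‖ ≤ n := (Nat.le_ceil _).trans (by exact_mod_cast hn)
  simp [trunc, this]

variable {H : Type*} [NormedAddCommGroup H] [InnerProductSpace ℂ H] [CompleteSpace H]
  {Z : Type*} [MeasurableSpace Z] {E : ResolutionOfIdentity H Z} {f : Z → ℂ}

lemma functionalCalculus_apply {x l : H}
    (h : Tendsto (fun n : ℕ => E.boundedIntegral (trunc f n) x) atTop (𝓝 l)) :
    ∃ hx : x ∈ (E.functionalCalculus f).domain, E.functionalCalculus f ⟨x, hx⟩ = l :=
  ⟨⟨l, h⟩, h.limUnder_eq⟩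

lemma tendsto_functionalCalculus (x : (E.functionalCalculus f).domain) :
    Tendsto (fun n : ℕ => E.boundedIntegral (trunc f n) (x : H)) atTop
      (𝓝 (E.functionalCalculus f x)) :=
  tendsto_nhds_limUnder x.2

/-- If `E` is carried by `S`, the spectrum of `f(E)` lies in the closure of `f(S)`: for `c` off this
closure, the integral of the bounded function `1_S / (c - f)` is the inverse of `c - f(E)`. -/
theorem unboundedSpectrum_functionalCalculus_subset (hf : Measurable f) {S : Set Z}
    (hS : MeasurableSet S) (hS1 : E S = 1) :
    unboundedSpectrum (E.functionalCalculus f) ⊆ closure (f '' S) := by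
  intro c hc
  by_contra hcl
  refine hc ?_
  obtain ⟨ε, hε, hball⟩ := Metric.isOpen_iff.1 isClosed_closure.isOpen_compl c hcl
  have hdist : ∀ z ∈ S, ε ≤ ‖c - f z‖ := by
    intro z hz
    by_contra hlt
    rw [not_le, ← dist_eq_norm, dist_comm] at hlt
    exact hball hlt (subset_closure ⟨z, hz, rfl⟩)
  have hne : ∀ z ∈ S, c - f z ≠ 0 := fun z hz h0 => by
    have := hdist z hz
    rw [h0, norm_zero] at this
    exact absurd hε this.not_gt
  let g : Z → ℂ := S.indicator fun z => (c - f z)⁻¹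
  have hgm : Measurable g := ((measurable_const.sub hf).inv).indicator hS
  have hgS : ∀ z ∈ S, g z = (c - f z)⁻¹ := fun z hz => Set.indicator_of_mem hz _
  have hgn : ∀ z, z ∉ S → g z = 0 := fun z hz => Set.indicator_of_notMem hz _
  have hgb : ∀ z, ‖g z‖ ≤ ε⁻¹ := by
    intro z
    by_cases hz : z ∈ S
    · rw [hgS z hz, norm_inv]
      exact inv_anti₀ hε (hdist z hz)
    · rw [hgn z hz, norm_zero]
      positivity
  have hg : BoundedMeasurable g := ⟨hgm, _, hgb⟩
  have hfg : ∀ z ∈ S, c * g z - f z * g z = 1 := fun z hz => by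
    rw [hgS z hz, ← sub_mul, mul_inv_cancel₀ (hne z hz)]
  have hfgb : ∀ z, ‖f z * g z‖ ≤ ‖c‖ * ε⁻¹ + 1 := by
    intro z
    by_cases hz : z ∈ S
    · have : f z * g z = c * g z - 1 := by rw [← hfg z hz]; ring
      rw [this]
      refine (norm_sub_le _ _).trans ?_
      rw [norm_mul, norm_one]
      gcongr
      exact hgb z
    · rw [hgn z hz, mul_zero, norm_zero]
      positivity
  have hfgm : BoundedMeasurable (f * g) := ⟨hf.mul hgm, _, hfgb⟩
  have hone : E.boundedIntegral (fun _ => 1) = 1 := by rw [boundedIntegral_const, one_smul]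
  refine ⟨E.boundedIntegral g, fun y => ?_, fun x => ?_⟩
  · have hlim : Tendsto (fun n => E.boundedIntegral (trunc f n) (E.boundedIntegral g y)) atTop
        (𝓝 (E.boundedIntegral (f * g) y)) := by
      have := tendsto_boundedIntegral (E := E) (G := fun n => trunc f n * g)
        (fun n => ((BoundedMeasurable.trunc hf n).mul hg).1) hfgm
        (fun n z => by
          refine le_trans ?_ (hfgb z)
          rw [Pi.mul_apply, norm_mul, norm_mul]
          exact mul_le_mul_of_nonneg_right (norm_trunc_le f n z) (norm_nonneg _))
        (fun z => (tendsto_trunc f z).mul_const _) y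
      simpa only [boundedIntegral_mul (BoundedMeasurable.trunc hf _) hg, mul_apply_eq_comp]
        using this
    obtain ⟨hx, hval⟩ := functionalCalculus_apply hlim
    refine ⟨hx, ?_⟩
    have hop : c • E.boundedIntegral g - E.boundedIntegral (f * g) = 1 := by
      rw [← hone, ← boundedIntegral_congr hS hS1 (((BoundedMeasurable.const c).mul hg).sub hfgm)
          (.const 1) hfg, boundedIntegral_sub ((BoundedMeasurable.const c).mul hg) hfgm,
        boundedIntegral_mul (.const c) hg, boundedIntegral_const, smul_mul_assoc, one_mul]
    rw [hval]
    exact congrArg (fun A : H →L[ℂ] H => A y) hop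
  · have hlim₁ : Tendsto (fun n : ℕ => E.boundedIntegral g
        (c • (x : H) - E.boundedIntegral (trunc f n) x)) atTop
        (𝓝 (E.boundedIntegral g (c • (x : H) - E.functionalCalculus f x))) :=
      ((E.boundedIntegral g).continuous.tendsto _).comp
        (tendsto_const_nhds.sub (tendsto_functionalCalculus x))
    refine tendsto_nhds_unique hlim₁ ?_
    have hG : ∀ n : ℕ, BoundedMeasurable ((fun _ => c) - trunc f n) := fun n =>
      (BoundedMeasurable.const c).sub (.trunc hf n)
    have hlim₂ := tendsto_boundedIntegral (E := E) (G := fun n => g * ((fun _ => c) - trunc f n))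
      (g := g * ((fun _ => c) - f)) (C := ‖c‖ * ε⁻¹ + (‖c‖ * ε⁻¹ + 1))
      (fun n => (hg.mul (hG n)).1) (by
        have : g * ((fun _ => c) - f) = (fun _ => c) * g - f * g := by ring
        rw [this]
        exact ((BoundedMeasurable.const c).mul hg).sub hfgm)
      (fun n z => by
        have : (g * ((fun _ => c) - trunc f n) : Z → ℂ) z = c * g z - trunc f n z * g z := by
          simp only [Pi.mul_apply, Pi.sub_apply]; ring
        rw [this]
        refine (norm_sub_le _ _).trans (add_le_add ?_ (le_trans ?_ (hfgb z)))
        · rw [norm_mul]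
          exact mul_le_mul_of_nonneg_left (hgb z) (norm_nonneg _)
        · rw [norm_mul, norm_mul]
          exact mul_le_mul_of_nonneg_right (norm_trunc_le f n z) (norm_nonneg _))
      (fun z => ((tendsto_const_nhds.sub (tendsto_trunc f z)).const_mul (g z))) (x : H)
    have hval : E.boundedIntegral (g * ((fun _ => c) - f)) = 1 := by
      rw [← hone]
      refine boundedIntegral_congr hS hS1 ?_ (.const 1) fun z hz => ?_
      · have : g * ((fun _ => c) - f) = (fun _ => c) * g - f * g := by ring
        rw [this]
        exact ((BoundedMeasurable.const c).mul hg).sub hfgm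
      · rw [← hfg z hz, Pi.mul_apply, Pi.sub_apply]; ring
    rw [hval, one_apply_eq_self] at hlim₂
    refine hlim₂.congr fun n => ?_
    rw [boundedIntegral_mul hg (hG n), boundedIntegral_sub (.const c) (.trunc hf n),
      boundedIntegral_const]
    rfl

/-- If `E` is carried by a set on which `f` is real, then `f(E)` is symmetric. -/
lemma isFormalAdjoint_functionalCalculus (hf : Measurable f) {S : Set Z} (hS : MeasurableSet S)
    (hS1 : E S = 1) (hreal : ∀ z ∈ S, star (f z) = f z) :
    (E.functionalCalculus f).IsFormalAdjoint (E.functionalCalculus f) := by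
  intro x y
  have h1 := (tendsto_functionalCalculus x).inner (𝕜 := ℂ) (tendsto_const_nhds (x := (y : H)))
  have h2 := (tendsto_const_nhds (x := (x : H))).inner (𝕜 := ℂ) (tendsto_functionalCalculus y)
  refine tendsto_nhds_unique h1 (h2.congr fun n => ?_)
  have hn := BoundedMeasurable.trunc hf n
  have h3 : ContinuousLinearMap.adjoint (E.boundedIntegral (trunc f n)) =
      E.boundedIntegral (trunc f n) := by
    rw [← ContinuousLinearMap.star_eq_adjoint, ← boundedIntegral_star hn]
    refine boundedIntegral_congr hS hS1 hn.star hn fun z hz => ?_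
    rw [Pi.star_apply, trunc, Set.indicator]
    split_ifs
    · exact hreal z hz
    · exact star_zero _
  rw [← ContinuousLinearMap.adjoint_inner_left, h3]

/-- If `E` is carried by a set `S` with `closure (f(S)) ⊆ ℝ`, then `f(E)` is selfadjoint. -/
theorem isSelfAdjoint_functionalCalculus (hf : Measurable f) {S : Set Z} (hS : MeasurableSet S)
    (hS1 : E S = 1) (hreal : closure (f '' S) ⊆ Set.range ((↑) : ℝ → ℂ)) :
    IsSelfAdjoint (E.functionalCalculus f) := by
  have hsurj : ∀ c : ℂ, c.im ≠ 0 → ∀ y, ∃ x : (E.functionalCalculus f).domain,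
      c • (x : H) - E.functionalCalculus f x = y := by
    intro c hc y
    have hc' : c ∉ unboundedSpectrum (E.functionalCalculus f) := fun h => by
      obtain ⟨r, rfl⟩ := hreal (unboundedSpectrum_functionalCalculus_subset hf hS hS1 h)
      exact hc (Complex.ofReal_im r)
    obtain ⟨B, hB, -⟩ := not_not.1 hc'
    obtain ⟨h, hy⟩ := hB y
    exact ⟨⟨B y, h⟩, hy⟩
  refine LinearPMap.isSelfAdjoint_of_surjective
    (isFormalAdjoint_functionalCalculus hf hS hS1 fun z hz => ?_)
    (hsurj _ (by simp)) (hsurj _ (by simp))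
  obtain ⟨r, hr⟩ := hreal (subset_closure ⟨z, hz, rfl⟩)
  rw [← hr]
  exact Complex.conj_ofReal r

end Operator

end ResolutionOfIdentity

theorem mainTheorem10 {H : Type*} [NormedAddCommGroup H] [InnerProductSpace ℂ H] [CompleteSpace H]
    {X : Type*} {R : X → Type*} [∀ x, MetricSpace (R x)] [∀ x, CompleteSpace (R x)]
    [∀ x, TopologicalSpace.SeparableSpace (R x)] [∀ x, MeasurableSpace (R x)]
    [∀ x, BorelSpace (R x)]
    (E : ∀ x, ResolutionOfIdentity H (R x)) (hE : ResolutionOfIdentity.IsCommutingFamily E)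
    (f : (∀ x, R x) → ℂ) (hf : Measurable f) :
    (∃! J : ResolutionOfIdentity H (∀ x, R x), ResolutionOfIdentity.IsJoint E hE J) ∧
    ∀ J : ResolutionOfIdentity H (∀ x, R x), ResolutionOfIdentity.IsJoint E hE J →
      (∀ Q : Finset X, unboundedSpectrum (J.functionalCalculus f) ⊆
        closure (f '' ResolutionOfIdentity.suppCylinder E Q)) ∧
      ((∃ A : Finset X, closure (f '' ResolutionOfIdentity.suppCylinder E A) ⊆
          Set.range ((↑) : ℝ → ℂ)) →
        IsSelfAdjoint (J.functionalCalculus f)) := by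
  have hpolish : ∀ x, PolishSpace (R x) := fun x => by
    have : SecondCountableTopology (R x) := UniformSpace.secondCountable_of_separable _
    infer_instance
  have hstd : ∀ x, StandardBorelSpace (R x) := fun x => inferInstance
  obtain ⟨J, hJ⟩ := ResolutionOfIdentity.exists_isJoint hE
  refine ⟨⟨J, hJ, fun J' hJ' => hJ'.unique hJ⟩, fun J hJ => ⟨fun Q => ?_, ?_⟩⟩
  · obtain ⟨hm, h1⟩ := hJ.apply_suppCylinder Q
    exact ResolutionOfIdentity.unboundedSpectrum_functionalCalculus_subset hf hm h1
  · rintro ⟨A, hA⟩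
    obtain ⟨hm, h1⟩ := hJ.apply_suppCylinder A
    exact ResolutionOfIdentity.isSelfAdjoint_functionalCalculus hf hm h1 hA
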